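/- For a field $K$ of characteristic $0$, the Chevalley--Bass number of $K$ is the smallest positive integer $\Lambda$ such that $(K(\zeta_{\Lambda n})^\times)^{\Lambda n}\cap K^\times\subseteq (K^\times)^n$ for every positive integer $n$. The conductor of an abelian number field $K$ is the smallest positive integer $f$ such that $K\subseteq\mathbb{Q}(\zeta_f)$. For positive integers $f,\lambda$ put $f'=\prod_{q\mid\lambda}q^{\operatorname{ord}_q(f)}$ if $4\mid f$ and $f'=4\prod_{q\mid\lambda}q^{\operatorname{ord}_q(f)}$ otherwise, the products being over primes $q$; call a positive integer $d$ allowed for $(f,\lambda)$ if $\operatorname{lcm}(4,\lambda,f'/\lambda)\mid d\mid f'$. Let $p$ be an odd prime. There exist primes $m$ with $p^4\mid m-1$. Let $m$ be any such prime, and for $\gamma\in(\mathbb{Z}/m\mathbb{Z})^\times$ of order $p^2$, $p^3$ or $p^4$ let $\Delta$ be the cyclic subgroup of $(\mathbb{Z}/p^4\mathbb{Z})^\times\times(\mathbb{Z}/m\mathbb{Z})^\times\simeq(\mathbb{Z}/p^4m\mathbb{Z})^\times\simeq\operatorname{Gal}(\mathbb{Q}(\zeta_{p^4m})/\mathbb{Q})$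 generated by $(1+p^2,\gamma)$, and let $K_\gamma=\mathbb{Q}(\zeta_{p^4m})^{\Delta}$. Then: 1. $K_\gamma$ has conductor $p^4m$ and contains exactly $2p^2$ roots of unity. 2. The Chevalley--Bass number of $K_\gamma$ exists, and it equals $4p^2$ if $\gamma$ has order $p^2$, $4p^3$ if $\gamma$ has order $p^3$, and $4p^4$ if $\gamma$ has order $p^4$. 3. The integers allowed for $(p^4m,2p^2)$ are exactly $4p^2$, $4p^3$ and $4p^4$, and the set of Chevalley--Bass numbers of the fields $K_\gamma$, where $\gamma$ runs through the elements of $(\mathbb{Z}/m\mathbb{Z})^\times$ of order $p^2$, $p^3$ or $p^4$, is exactly this set. -/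

import Mathlib

noncomputable section

/-- `Λ` is positive and, for every positive integer `n`,
`(K(ζ_{Λ n})ˣ) ^ (Λ n) ∩ Kˣ ⊆ (Kˣ) ^ n`. -/
def HasChevalleyBassProperty (K : Type*) [Field K] [CharZero K] (Λ : ℕ) : Prop :=
  0 < Λ ∧ ∀ n : ℕ, 0 < n → ∀ x : Kˣ,
    (∃ y : (CyclotomicField (Λ * n) K)ˣ,
      (y : CyclotomicField (Λ * n) K) ^ (Λ * n) =
        algebraMap K (CyclotomicField (Λ * n) K) (x : K)) →
    ∃ z : Kˣ, z ^ n = x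

/-- `Λ` is the Chevalley-Bass number of `K`: the smallest positive integer with the
Chevalley-Bass property (this asserts in particular that there is one). -/
def IsChevalleyBassNumber (K : Type*) [Field K] [CharZero K] (Λ : ℕ) : Prop :=
  IsLeast {l : ℕ | HasChevalleyBassProperty K l} Λ

/-- `f` is the (finite part of the) conductor of the abelian number field `K`: the smallest
positive integer such that `K` embeds into `ℚ(ζ_f)`. -/
def IsAbelianConductor (K : Type*) [Field K] [CharZero K] (f : ℕ) : Prop :=
  IsLeast {d : ℕ | 0 < d ∧ Nonempty (K →ₐ[ℚ] CyclotomicField d ℚ)} f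

/-- The number of roots of unity in `K`, that is, the number of elements of finite order in `Kˣ`
(`0` if there are infinitely many). -/
def numRootsOfUnity (K : Type*) [Field K] : ℕ :=
  Nat.card (CommGroup.torsion Kˣ)

/-- The integer `f'` attached to a conductor `f` and a number `l` of roots of unity:
the product of `p ^ ord_p(f)` over the primes `p ∣ l`, multiplied by `4` if `4 ∤ f`. -/
def chevalleyBassUpperBound (f l : ℕ) : ℕ :=
  if 4 ∣ f then ∏ q ∈ l.primeFactors, q ^ f.factorization q
  else 4 * ∏ q ∈ l.primeFactors, q ^ f.factorization q

/-- The integers `Λ` with `lcm(4, l, f' / l) ∣ Λ ∣ f'`. -/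
def allowedChevalleyBassNumbers (f l : ℕ) : Set ℕ :=
  {d : ℕ | Nat.lcm 4 (Nat.lcm l (chevalleyBassUpperBound f l / l)) ∣ d ∧
    d ∣ chevalleyBassUpperBound f l}

theorem coprime_pow_four_of_dvd_sub_one {p m : ℕ} [hm : Fact m.Prime] (h : p ^ 4 ∣ m - 1) :
    Nat.Coprime (p ^ 4) m := by
  have h1 : Nat.Coprime (m - 1) m := by
    have := (Nat.coprime_self_add_right (m := m - 1) (n := 1)).2 (Nat.coprime_one_right _)
    rwa [Nat.sub_add_cancel hm.out.one_lt.le] at this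
  exact Nat.Coprime.coprime_dvd_left h h1

theorem coprime_one_add_sq_pow_four (p : ℕ) : Nat.Coprime (1 + p ^ 2) (p ^ 4) := by
  apply Nat.Coprime.pow_right
  rw [pow_two, Nat.coprime_add_mul_left_left]
  exact Nat.coprime_one_left p

/-- The Chinese remainder isomorphism
`(ℤ/p⁴m)ˣ ≃ (ℤ/p⁴)ˣ × (ℤ/m)ˣ`, given by the two reduction maps. -/
def unitsChineseRemainder {p m : ℕ} (h : Nat.Coprime (p ^ 4) m) :
    (ZMod (p ^ 4 * m))ˣ ≃* (ZMod (p ^ 4))ˣ × (ZMod m)ˣ :=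
  (Units.mapEquiv (ZMod.chineseRemainder h).toMulEquiv).trans MulEquiv.prodUnits

/-- The cyclic subgroup `Δ` of `(ℤ/p⁴m)ˣ = (ℤ/p⁴)ˣ × (ℤ/m)ˣ` generated by `(1 + p², γ)`. -/
def exampleSubgroup {p m : ℕ} (h : Nat.Coprime (p ^ 4) m) (γ : (ZMod m)ˣ) :
    Subgroup (ZMod (p ^ 4 * m))ˣ :=
  Subgroup.zpowers ((unitsChineseRemainder h).symm
    (ZMod.unitOfCoprime (1 + p ^ 2) (coprime_one_add_sq_pow_four p), γ))

/-- The field `K = ℚ(ζ_{p⁴m})^Δ`, as a subfield of a given cyclotomic field `L = ℚ(ζ_{p⁴m})`;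
here a class `a` modulo `p⁴m` acts on `L` by the automorphism raising `ζ_{p⁴m}` to the
power `a`. -/
def exampleField {p m : ℕ} [NeZero (p ^ 4 * m)] (h : Nat.Coprime (p ^ 4) m) (γ : (ZMod m)ˣ)
    (L : Type*) [Field L] [NumberField L] [IsCyclotomicExtension {p ^ 4 * m} ℚ L] :
    IntermediateField ℚ L :=
  IntermediateField.fixedField
    ((exampleSubgroup h γ).comap
      (IsCyclotomicExtension.Rat.galEquivZMod (p ^ 4 * m) L).toMonoidHom)

end

/-! ### Kummer cocycles with a central automorphism -/

section Kummer

variable {K F : Type*} [Field K] [Field F] [Algebra K F]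

/-! Write K for the field attached to γ of order p^j, and L = ℚ(ζ_{p⁴m}). If y ^ Q = x with x in K
and y in F = K(ζ_N), where Q ∣ N, then g y = ζ^{c(g)} y defines a cocycle c modulo Q, twisted by the
cyclotomic character χ. With Q = l n, the element x is an n-th power in K as soon as c is a
coboundary modulo n (`exists_pow_eq_of_coboundary`). Since F/K is abelian, each s in its Galois
group gives (χ(s) - 1) c(g) ≡ (χ(g) - 1) c(s) modulo Q (`dvd_of_commute`), and a well chosen s makes
c a coboundary.

To see that 4p^j has the Chevalley-Bass property, treat each prime q ∣ n separately, with a =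
ord_q(n). For q ≠ 2, p some s has χ(s) - 1 prime to q. For q = 2 take χ(s) = -1; the spare factor 4
and an involution with character 1 + 2^(a+1) give the required divisibility by 2. For q = p lift the
generator of Δ to s with χ(s) = 1 + p² and s of order dividing p^e, e = max(a + j - 2, j). Then s ^
p^e = 1 forces p^(a+j-e) ∣ c(s): either p² ∣ c(s), and c is a coboundary modulo p^a, or p^a ∣ c(s),
and c vanishes modulo p^a. The order of γ enters through e.

For minimality, 4 ∣ l follows from (1 + i)⁴ = -4 and i ∉ K (`HasChevalleyBassProperty.four_dvd`).
Also L/K is cyclic of degree p^j, and Hilbert 90 gives y in L on which the generator acts by a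
primitive p^j-th root of unity. Its powers contradict the property unless p^j ∣ l
(`HasChevalleyBassProperty.pow_dvd`).

The conductor and the roots of unity are read off from the classes in Δ. For the allowed integers,
f' = 4p⁴ and f'/λ = λ = 2p². -/

theorem exists_algEquiv_apply_eq_zpow_mul {Q : ℕ} (hQ : Q ≠ 0) {ζ y : F} {x : K}
    (hζ : IsPrimitiveRoot ζ Q) (hy : y ≠ 0) (hyx : y ^ Q = algebraMap K F x)
    (g : F ≃ₐ[K] F) : ∃ c : ℤ, g y = ζ ^ c * y := by
  have : NeZero Q := ⟨hQ⟩
  have h : (g y / y) ^ Q = 1 := by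
    rw [div_pow, ← map_pow, hyx, AlgEquiv.commutes, div_self]
    rw [← hyx]; exact pow_ne_zero _ hy
  obtain ⟨i, -, hi⟩ := hζ.eq_pow_of_pow_eq_one h
  exact ⟨i, by rw [zpow_natCast, hi, div_mul_cancel₀ _ hy]⟩

theorem exists_algEquiv_apply_eq_zpow {Q : ℕ} (hQ : Q ≠ 0) {ζ : F}
    (hζ : IsPrimitiveRoot ζ Q) (g : F ≃ₐ[K] F) : ∃ c : ℤ, g ζ = ζ ^ c := by
  have : NeZero Q := ⟨hQ⟩
  have h : (g ζ) ^ Q = 1 := by rw [← map_pow, hζ.pow_eq_one, map_one]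
  obtain ⟨i, -, hi⟩ := hζ.eq_pow_of_pow_eq_one h
  exact ⟨i, by rw [zpow_natCast, hi]⟩

/-- The element y^l ζ^(-tl) is Galois invariant: the discrepancy c - (χ - 1)t is a multiple of n,
and raising to the power l turns it into a multiple of ln. Its n-th power is still x because ζ^(ln)
= 1. -/
theorem exists_pow_eq_of_coboundary [IsGalois K F] [FiniteDimensional K F] {n l : ℕ} {ζ y : F}
    {x : K} (hζ : IsPrimitiveRoot ζ (l * n)) (hln : l * n ≠ 0) (hy : y ≠ 0)
    (hyx : y ^ (l * n) = algebraMap K F x) (t : ℤ)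
    (h : ∀ (g : F ≃ₐ[K] F) (c χ : ℤ), g y = ζ ^ c * y → g ζ = ζ ^ χ →
      (n : ℤ) ∣ c - (χ - 1) * t) : ∃ z : K, z ^ n = x := by
  have hζ0 : ζ ≠ 0 := hζ.ne_zero hln
  have hfix : ∀ g : F ≃ₐ[K] F, g (y ^ l * ζ ^ (-(t * l))) = y ^ l * ζ ^ (-(t * l)) := by
    intro g
    obtain ⟨c, hc⟩ := exists_algEquiv_apply_eq_zpow_mul hln hζ hy hyx g
    obtain ⟨χ, hχ⟩ := exists_algEquiv_apply_eq_zpow hln hζ g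
    obtain ⟨u, hu⟩ := h g c χ hc hχ
    have h1 : ζ ^ ((c - (χ - 1) * t) * l) = 1 := by
      rw [hζ.zpow_eq_one_iff_dvd, hu]
      exact ⟨u, by push_cast; ring⟩
    rw [map_mul, map_pow, map_zpow₀, hc, hχ, mul_pow, ← zpow_natCast (ζ ^ c), ← zpow_mul,
      ← zpow_mul]
    have : c * l + χ * (-(t * l)) = (c - (χ - 1) * t) * l + -(t * l) := by ring
    calc ζ ^ (c * (l : ℤ)) * y ^ l * ζ ^ (χ * (-(t * l)))
        = y ^ l * (ζ ^ (c * l + χ * (-(t * l)))) := by rw [zpow_add₀ hζ0]; ring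
      _ = _ := by rw [this, zpow_add₀ hζ0, h1, one_mul]
  obtain ⟨z, hz⟩ := (IsGalois.mem_range_algebraMap_iff_fixed _).2 hfix
  refine ⟨z, (algebraMap K F).injective ?_⟩
  have h2 : ζ ^ (-(t * l) * n) = 1 := by
    rw [hζ.zpow_eq_one_iff_dvd]
    exact ⟨-t, by push_cast; ring⟩
  rw [map_pow, hz, mul_pow, ← pow_mul, hyx, ← zpow_natCast, ← zpow_mul, h2, mul_one]

/-- Evaluate s g and g s on y and compare exponents of ζ. This is Sah's argument: a central s makes
χ(s) - 1 annihilate the class of the cocycle. -/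
theorem dvd_of_commute {Q : ℕ} {ζ y : F} (hζ : IsPrimitiveRoot ζ Q) (hQ : Q ≠ 0)
    (hy : y ≠ 0) {s g : F ≃ₐ[K] F} (hsg : s * g = g * s) {cs cg χs χg : ℤ}
    (hcs : s y = ζ ^ cs * y) (hcg : g y = ζ ^ cg * y) (hχs : s ζ = ζ ^ χs) (hχg : g ζ = ζ ^ χg) :
    (Q : ℤ) ∣ (χs - 1) * cg - (χg - 1) * cs := by
  have hζ0 : ζ ≠ 0 := hζ.ne_zero hQ
  have h := DFunLike.congr_fun hsg y
  rw [AlgEquiv.mul_apply, AlgEquiv.mul_apply, hcg, hcs, map_mul, map_mul, map_zpow₀, map_zpow₀,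
    hχs, hχg, hcs, hcg, ← zpow_mul, ← zpow_mul, ← mul_assoc, ← mul_assoc, ← zpow_add₀ hζ0,
    ← zpow_add₀ hζ0] at h
  have h' := mul_right_cancel₀ hy h
  rw [← hζ.zpow_eq_one_iff_dvd, show (χs - 1) * cg - (χg - 1) * cs =
    (χs * cg + cs) - (χg * cs + cg) by ring, zpow_sub₀ hζ0, h', div_self (zpow_ne_zero _ hζ0)]

theorem algEquiv_pow_apply {ζ y : F} (hζ0 : ζ ≠ 0) {s : F ≃ₐ[K] F} {c χ : ℤ}
    (hc : s y = ζ ^ c * y) (hχ : s ζ = ζ ^ χ) (i : ℕ) :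
    (s ^ i) y = ζ ^ (c * ∑ k ∈ Finset.range i, χ ^ k) * y := by
  induction i with
  | zero => simp
  | succ i ih =>
    rw [pow_succ', AlgEquiv.mul_apply, ih, map_mul, map_zpow₀, hχ, hc, ← zpow_mul, ← mul_assoc,
      ← zpow_add₀ hζ0, geom_sum_succ]
    congr 2
    ring

theorem dvd_mul_geom_sum_of_pow_eq_one {Q : ℕ} (hQ : Q ≠ 0) {ζ y : F} (hζ : IsPrimitiveRoot ζ Q)
    (hy : y ≠ 0) {s : F ≃ₐ[K] F} {c χ : ℤ}
    (hc : s y = ζ ^ c * y) (hχ : s ζ = ζ ^ χ) {i : ℕ} (hs : s ^ i = 1) :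
    (Q : ℤ) ∣ c * ∑ k ∈ Finset.range i, χ ^ k := by
  have h := algEquiv_pow_apply (hζ.ne_zero hQ) hc hχ i
  rw [hs, AlgEquiv.one_apply] at h
  rw [← hζ.zpow_eq_one_iff_dvd]
  exact mul_right_cancel₀ hy (by rw [← h, one_mul])

variable [IsGalois K F] [FiniteDimensional K F]

theorem exists_pow_eq_of_isCoprime {n : ℕ} (hn : n ≠ 0) {ζ y : F} {x : K}
    (hζ : IsPrimitiveRoot ζ n) (hy : y ≠ 0) (hyx : y ^ n = algebraMap K F x)
    {s : F ≃ₐ[K] F} (hcomm : ∀ g : F ≃ₐ[K] F, s * g = g * s) {χ : ℤ} (hχ : s ζ = ζ ^ χ)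
    (hcop : IsCoprime (χ - 1) n) : ∃ z : K, z ^ n = x := by
  obtain ⟨c, hc⟩ := exists_algEquiv_apply_eq_zpow_mul hn hζ hy hyx s
  obtain ⟨u, v, huv⟩ := hcop
  refine exists_pow_eq_of_coboundary (l := 1) (by simpa using hζ) (by simpa using hn) hy
    (by simpa using hyx) (c * u) fun g cg χg hcg hχg ↦ ?_
  have h := dvd_of_commute hζ hn hy (hcomm g) hc hcg hχ hχg
  rw [show cg - (χg - 1) * (c * u) = u * ((χ - 1) * cg - (χg - 1) * c) + n * (v * cg) by
    linear_combination (-cg) * huv]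
  exact dvd_add (h.mul_left _) (dvd_mul_right _ _)

/-- Centrality of s gives -2 c(g) ≡ (χ(g) - 1) c(s) modulo 2^(a+2), so c is a coboundary modulo 2^a
once c(s) is even. The involution r provides this: r² = 1 forces 2^(a+1) ∣ c(r), and then
commutation of s with r forces 2^(a+2) ∣ 2^(a+1) c(s). -/
theorem exists_pow_eq_of_two_pow {a : ℕ} (ha : 1 ≤ a) {ζ y : F} {x : K}
    (hζ : IsPrimitiveRoot ζ (4 * 2 ^ a)) (hy : y ≠ 0) (hyx : y ^ (4 * 2 ^ a) = algebraMap K F x)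
    {s r : F ≃ₐ[K] F} (hcomm : ∀ g : F ≃ₐ[K] F, s * g = g * s) (hs : s ζ = ζ ^ (-1 : ℤ))
    (hr : r ζ = ζ ^ (1 + 2 ^ (a + 1) : ℤ)) (hr2 : r ^ 2 = 1) : ∃ z : K, z ^ (2 ^ a) = x := by
  have hQ : 4 * 2 ^ a ≠ 0 := by positivity
  obtain ⟨a, rfl⟩ := Nat.exists_eq_add_of_le' ha
  obtain ⟨c, hc⟩ := exists_algEquiv_apply_eq_zpow_mul hQ hζ hy hyx s
  obtain ⟨d, hd⟩ := exists_algEquiv_apply_eq_zpow_mul hQ hζ hy hyx r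
  obtain ⟨u, hu⟩ := dvd_mul_geom_sum_of_pow_eq_one hQ hζ hy hd hr hr2
  obtain ⟨v, hv⟩ := dvd_of_commute hζ hQ hy (hcomm r) hc hd hs hr
  simp only [Finset.sum_range_succ, Finset.sum_range_zero] at hu
  push_cast at hu hv
  have h2 : (2 : ℤ) ^ a ≠ 0 := by positivity
  -- `d` is killed by multiplication by two times an odd number
  have hd' : (2 : ℤ) ^ (a + 2) ∣ d := by
    have : IsCoprime ((2 : ℤ) ^ (a + 2)) (1 + 2 ^ (a + 1)) := by
      refine IsCoprime.pow_left ⟨-2 ^ a, 1, by ring⟩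
    refine this.dvd_of_dvd_mul_right ⟨u, ?_⟩
    apply mul_left_cancel₀ (two_ne_zero (α := ℤ))
    linear_combination hu
  obtain ⟨w, hw⟩ := hd'
  have hc2 : c = 2 * (-w - v) := by
    apply mul_left_cancel₀ (a := (2 : ℤ) ^ a * 4) (by positivity)
    rw [hw] at hv
    linear_combination (-1 : ℤ) * hv
  refine exists_pow_eq_of_coboundary hζ hQ hy hyx (w + v) fun g cg χg hcg hχg ↦ ?_
  obtain ⟨k, hk⟩ := dvd_of_commute hζ hQ hy (hcomm g) hc hcg hs hχg
  push_cast at hk ⊢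
  refine ⟨-2 * k, ?_⟩
  apply mul_left_cancel₀ (a := (-2 : ℤ)) (by norm_num)
  rw [hc2] at hk
  linear_combination hk

/-- Lifting the exponent: (1 + p²)^(p^e) - 1 has p-adic valuation e + 2, of which the factor (1 +
p²) - 1 accounts for 2. -/
theorem exists_geom_sum_eq_prime_pow_mul {p : ℕ} (hp : p.Prime) (hp2 : p ≠ 2) (e : ℕ) :
    ∃ u : ℤ, IsCoprime u p ∧
      ∑ k ∈ Finset.range (p ^ e), (1 + (p : ℤ) ^ 2) ^ k = p ^ e * u := by
  have hpi : Prime (p : ℤ) := Nat.prime_iff_prime_int.1 hp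
  have hgs := geom_sum_mul (1 + (p : ℤ) ^ 2) (p ^ e)
  have hlte := Int.emultiplicity_pow_sub_pow hp (hp.odd_of_ne_two hp2) (x := 1 + (p : ℤ) ^ 2)
    (y := 1) ⟨p, by ring⟩ (fun h ↦ hpi.not_isUnit (isUnit_of_dvd_one
      ((dvd_add_left ⟨(p : ℤ), by ring⟩).1 h))) (p ^ e)
  rw [one_pow, ← hgs, emultiplicity_mul hpi, add_comm, add_sub_cancel_left,
    emultiplicity_pow_self hpi.ne_zero hpi.not_isUnit,
    emultiplicity_pow_self hp.ne_zero (fun h ↦ hp.one_lt.ne' (Nat.isUnit_iff.1 h))] at hlte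
  have h := WithTop.add_left_cancel (ENat.natCast_ne_top 2) hlte
  obtain ⟨⟨u, hu⟩, h2⟩ := emultiplicity_eq_coe.1 h
  refine ⟨u, ?_, hu⟩
  rw [isCoprime_comm, Prime.coprime_iff_not_dvd hpi]
  rintro ⟨v, rfl⟩
  exact h2 ⟨v, by rw [hu]; ring⟩

/-- Write χ(g) - 1 = p² h. Commutation with s, after cancelling p², gives c(g) ≡ h c(s) modulo p^a,
and s ^ p^e = 1 gives p^(a+j-e) ∣ c(s). For e = a + j - 2 the coboundary uses t = c(s)/p²; for e = j
the cocycle is zero modulo p^a. -/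
theorem exists_pow_eq_of_odd_prime_pow {p : ℕ} (hp : p.Prime) (hp2 : p ≠ 2) {j a e : ℕ}
    (hj : 2 ≤ j) (he : e = a + j - 2 ∨ e = j) {ζ y : F} {x : K}
    (hζ : IsPrimitiveRoot ζ (p ^ j * p ^ a)) (hy : y ≠ 0)
    (hyx : y ^ (p ^ j * p ^ a) = algebraMap K F x)
    {s : F ≃ₐ[K] F} (hcomm : ∀ g : F ≃ₐ[K] F, s * g = g * s)
    (hs : s ζ = ζ ^ (1 + p ^ 2 : ℤ)) (hse : s ^ (p ^ e) = 1)
    (hall : ∀ (g : F ≃ₐ[K] F) (χ : ℤ), g ζ = ζ ^ χ → (p : ℤ) ^ 2 ∣ χ - 1) :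
    ∃ z : K, z ^ (p ^ a) = x := by
  have hQ : p ^ j * p ^ a ≠ 0 := by have := hp.pos; positivity
  have hp0 : (p : ℤ) ≠ 0 := by exact_mod_cast hp.ne_zero
  obtain ⟨c, hc⟩ := exists_algEquiv_apply_eq_zpow_mul hQ hζ hy hyx s
  have h1 := dvd_mul_geom_sum_of_pow_eq_one hQ hζ hy hc hs hse
  obtain ⟨u, hup, hu⟩ := exists_geom_sum_eq_prime_pow_mul hp hp2 e
  rw [hu] at h1
  have key : ∀ (g : F ≃ₐ[K] F) (cg χg : ℤ), g y = ζ ^ cg * y → g ζ = ζ ^ χg →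
      ∃ h : ℤ, χg - 1 = p ^ 2 * h ∧ (p : ℤ) ^ a ∣ cg - h * c := by
    intro g cg χg hcg hχg
    obtain ⟨h, hh⟩ := hall g χg hχg
    refine ⟨h, hh, ?_⟩
    obtain ⟨v, hv⟩ := dvd_of_commute hζ hQ hy (hcomm g) hc hcg hs hχg
    refine ⟨p ^ (j - 2) * v, mul_left_cancel₀ (pow_ne_zero 2 hp0) ?_⟩
    push_cast at hv
    have : (p : ℤ) ^ j = p ^ 2 * p ^ (j - 2) := by rw [← pow_add]; congr 1; omega
    rw [this, hh] at hv
    linear_combination hv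
  have hcancel : ∀ i : ℕ, a + j = e + i → (p : ℤ) ^ i ∣ c := by
    intro i hi
    have : ((p : ℤ) ^ e) * p ^ i ∣ p ^ e * (c * u) := by
      refine dvd_trans ?_ (h1.trans (dvd_of_eq (by ring)))
      rw [← pow_add, ← hi]
      exact dvd_of_eq (by push_cast; ring)
    exact (IsCoprime.pow_right hup).symm.dvd_of_dvd_mul_right
      ((mul_dvd_mul_iff_left (pow_ne_zero e hp0)).1 this)
  rcases he with he | he
  · obtain ⟨w, hw⟩ := hcancel 2 (by omega)
    refine exists_pow_eq_of_coboundary hζ hQ hy hyx w fun g cg χg hcg hχg ↦ ?_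
    obtain ⟨h, hh, hd⟩ := key g cg χg hcg hχg
    push_cast
    rwa [hh, mul_right_comm, ← hw, mul_comm c]
  · refine exists_pow_eq_of_coboundary hζ hQ hy hyx 0 fun g cg χg hcg hχg ↦ ?_
    obtain ⟨h, hh, hd⟩ := key g cg χg hcg hχg
    push_cast
    rw [mul_zero, sub_zero]
    exact (dvd_sub_left ((hcancel a (by omega)).mul_left h)).1 hd

end Kummer

/-- Bézout combines roots of coprime exponents; this localises the Chevalley-Bass property at one
prime of n at a time. -/
theorem exists_pow_eq_of_forall_prime {G : Type*} [CommGroup G] (x : G) (n : ℕ) (hn : n ≠ 0)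
    (h : ∀ q : ℕ, q.Prime → q ∣ n → ∃ z : G, z ^ (q ^ n.factorization q) = x) :
    ∃ z : G, z ^ n = x := by
  induction n using Nat.recOnPosPrimePosCoprime with
  | zero => exact absurd rfl hn
  | one => exact ⟨x, pow_one x⟩
  | prime_pow q a hq ha =>
    simpa [hq.factorization_pow] using h q hq (dvd_pow_self q ha.ne')
  | coprime a b ha hb hab iha ihb =>
    obtain ⟨z, hz⟩ := iha (by omega) fun q hq hqa ↦ by
      have := h q hq (hqa.mul_right b)
      rwa [Nat.factorization_eq_of_coprime_left hab
        ((Nat.mem_primeFactorsList_iff_dvd (by omega) hq).2 hqa)] at this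
    obtain ⟨w, hw⟩ := ihb (by omega) fun q hq hqb ↦ by
      have := h q hq (hqb.mul_left a)
      rwa [Nat.factorization_eq_of_coprime_right hab
        ((Nat.mem_primeFactorsList_iff_dvd (by omega) hq).2 hqb)] at this
    obtain ⟨u, v, huv⟩ := Nat.isCoprime_iff_coprime.2 hab
    refine ⟨w ^ u * z ^ v, ?_⟩
    calc (w ^ u * z ^ v) ^ (a * b) = (w ^ b) ^ (u * a) * (z ^ a) ^ (v * b) := by
          rw [mul_pow, ← zpow_natCast, ← zpow_natCast, ← zpow_natCast w, ← zpow_natCast z,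
            ← zpow_mul, ← zpow_mul, ← zpow_mul, ← zpow_mul]
          congr 2 <;> push_cast <;> ring
      _ = x := by rw [hz, hw, ← zpow_add, huv, zpow_one]

/-! ### Residue classes acting on fixed fields of cyclotomic fields -/

section Galois

open IsCyclotomicExtension.Rat

/-- Irreducibility of the cyclotomic polynomial over ℚ: ζ and ζ^a have the same minimal polynomial.
-/
theorem exists_algEquiv_pow_of_coprime (Ω : Type*) [Field Ω] [CharZero Ω] [hA : Algebra ℚ Ω]
    [IsAlgClosed Ω] [Algebra.IsAlgebraic ℚ Ω] {M a : ℕ} (hM : M ≠ 0) (ha : a.Coprime M) :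
    ∃ σ : Ω ≃ₐ[ℚ] Ω, ∀ z : Ω, z ^ M = 1 → σ z = z ^ a := by
  have : NeZero M := ⟨hM⟩
  obtain rfl := Subsingleton.elim hA DivisionRing.toRatAlgebra
  have : IsAlgClosure ℚ Ω := ⟨inferInstance, inferInstance⟩
  have : Normal ℚ Ω := IsAlgClosure.normal ℚ Ω
  obtain ⟨ζ, hζ⟩ := HasEnoughRootsOfUnity.exists_primitiveRoot Ω M
  have hζa : IsPrimitiveRoot (ζ ^ a) M := hζ.pow_of_coprime a ha
  obtain ⟨σ, hσ⟩ := minpoly.exists_algEquiv_of_root (K := ℚ) (x := ζ) (y := ζ ^ a)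
    (Algebra.IsAlgebraic.isAlgebraic _) (by
      rw [← Polynomial.cyclotomic_eq_minpoly_rat hζa (Nat.pos_of_ne_zero hM),
        Polynomial.cyclotomic_eq_minpoly_rat hζ (Nat.pos_of_ne_zero hM)]
      exact minpoly.aeval _ _)
  refine ⟨σ, fun z hz ↦ ?_⟩
  obtain ⟨i, -, rfl⟩ := hζ.eq_pow_of_pow_eq_one hz
  rw [map_pow, hσ, pow_right_comm]

variable {n : ℕ} [NeZero n] (L : Type*) [Field L] [NumberField L] [IsCyclotomicExtension {n} ℚ L]
  (H : Subgroup (ZMod n)ˣ)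

/-- The subfield of the `n`-th cyclotomic field fixed by a subgroup of `(ℤ/n)ˣ`. -/
noncomputable abbrev cyclotomicFixedField : IntermediateField ℚ L :=
  IntermediateField.fixedField (H.comap (galEquivZMod n L).toMonoidHom)

variable {L H}

theorem mem_cyclotomicFixedField_iff {x : L} :
    x ∈ cyclotomicFixedField L H ↔ ∀ τ : L ≃ₐ[ℚ] L, galEquivZMod n L τ ∈ H → τ x = x := by
  rw [IntermediateField.mem_fixedField_iff]
  rfl

theorem pow_eq_self_of_mem_cyclotomicFixedField {x : L} (hx : x ∈ cyclotomicFixedField L H)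
    (hxn : x ^ n = 1) {a : ℕ} (ha : a.Coprime n) (haH : ZMod.unitOfCoprime a ha ∈ H) :
    x ^ a = x := by
  have h := mem_cyclotomicFixedField_iff.1 hx ((galEquivZMod n L).symm (ZMod.unitOfCoprime a ha))
    (by rwa [MulEquiv.apply_symm_apply])
  rw [galEquivZMod_apply_of_pow_eq n L _ hxn, MulEquiv.apply_symm_apply, ZMod.coe_unitOfCoprime,
    ZMod.val_natCast, ← pow_eq_pow_mod a hxn] at h
  exact h

theorem galEquivZMod_eq_unitOfCoprime {τ : L ≃ₐ[ℚ] L} {a : ℕ} (ha : a.Coprime n)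
    (h : ∀ z : L, z ^ n = 1 → τ z = z ^ a) : galEquivZMod n L τ = ZMod.unitOfCoprime a ha := by
  have hζ := IsCyclotomicExtension.zeta_spec n ℚ L
  have h1 := h _ hζ.pow_eq_one
  rw [galEquivZMod_apply_of_pow_eq n L _ hζ.pow_eq_one,
    (hζ.isOfFinOrder (NeZero.ne _)).pow_inj_mod, ← hζ.eq_orderOf,
    ← ZMod.natCast_eq_natCast_iff', ZMod.natCast_val, ZMod.cast_id] at h1
  rwa [Units.ext_iff]

theorem forall_apply_eq_iff_mem {Ω : Type*} [Field Ω] [Algebra ℚ Ω] [Algebra L Ω]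
    [IsScalarTower ℚ L Ω] {σ : Ω ≃ₐ[ℚ] Ω} {a : ℕ} (ha : a.Coprime n)
    (hσ : ∀ z : Ω, z ^ n = 1 → σ z = z ^ a) :
    (∀ x ∈ cyclotomicFixedField L H, σ (algebraMap L Ω x) = algebraMap L Ω x) ↔
      ZMod.unitOfCoprime a ha ∈ H := by
  have : IsGalois ℚ L := IsCyclotomicExtension.isGalois {n} ℚ L
  have hτ : galEquivZMod n L (σ.restrictNormal L) = ZMod.unitOfCoprime a ha := by
    refine galEquivZMod_eq_unitOfCoprime ha fun z hz ↦ (algebraMap L Ω).injective ?_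
    rw [AlgEquiv.restrictNormal_commutes, map_pow, hσ _ (by rw [← map_pow, hz, map_one])]
  have h1 : σ.restrictNormal L ∈ (cyclotomicFixedField L H).fixingSubgroup ↔
      ZMod.unitOfCoprime a ha ∈ H := by
    rw [IntermediateField.fixingSubgroup_fixedField, ← hτ]
    rfl
  rw [← h1, IntermediateField.mem_fixingSubgroup_iff]
  refine forall₂_congr fun x _ ↦ ?_
  rw [← AlgEquiv.restrictNormal_commutes, (algebraMap L Ω).injective.eq_iff]

theorem exists_algEquiv_pow_of_algEquiv {K F Ω : Type*} [Field K] [Field F] [Field Ω] [CharZero K]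
    [Algebra K F] [Algebra K Ω] [IsAlgClosed Ω] {N : ℕ} (hN : N ≠ 0)
    [IsCyclotomicExtension {N} K F] {a : ℕ} (σ : Ω ≃ₐ[K] Ω)
    (hσ : ∀ z : Ω, z ^ N = 1 → σ z = z ^ a) :
    ∃ τ : F ≃ₐ[K] F, ∀ z : F, z ^ N = 1 → τ z = z ^ a := by
  have : NeZero N := ⟨hN⟩
  have : FiniteDimensional K F := IsCyclotomicExtension.finiteDimensional {N} _ F
  have : IsGalois K F := IsCyclotomicExtension.isGalois {N} _ F
  let φ : F →ₐ[K] Ω := IsAlgClosed.lift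
  let _ : Algebra F Ω := φ.toRingHom.toAlgebra
  have : IsScalarTower K F Ω := IsScalarTower.of_algebraMap_eq fun x ↦ (φ.commutes x).symm
  refine ⟨σ.restrictNormal F, fun z hz ↦ (algebraMap F Ω).injective ?_⟩
  rw [AlgEquiv.restrictNormal_commutes, map_pow, hσ _ (by rw [← map_pow, hz, map_one])]

/-- An automorphism of the algebraic closure raising roots of unity of order dividing N n to the
power a fixes K because a lies in H; it therefore restricts to the normal extension F of K. -/
theorem exists_algEquiv_cyclotomicFixedField {K : IntermediateField ℚ L}
    (hK : K = cyclotomicFixedField L H) (F : Type*) [Field F] [Algebra K F] {N : ℕ} (hN : N ≠ 0)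
    [IsCyclotomicExtension {N} K F] {a : ℕ} (haN : a.Coprime N)
    (ha : a.Coprime n) (haH : ZMod.unitOfCoprime a ha ∈ H) :
    ∃ σ : F ≃ₐ[K] F, ∀ z : F, z ^ N = 1 → σ z = z ^ a := by
  subst hK
  let Ω := AlgebraicClosure L
  have : Algebra.IsAlgebraic ℚ Ω := Algebra.IsAlgebraic.trans ℚ L Ω
  obtain ⟨σ, hσ⟩ := exists_algEquiv_pow_of_coprime Ω (mul_ne_zero hN (NeZero.ne n))
    (Nat.Coprime.mul_right haN ha)
  have hfix := (forall_apply_eq_iff_mem (L := L) (H := H) (Ω := Ω) (σ := σ) ha fun z hz ↦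
    hσ z (by rw [mul_comm, pow_mul, hz, one_pow])).2 haH
  exact exists_algEquiv_pow_of_algEquiv hN
    (AlgEquiv.ofRingEquiv (f := σ.toRingEquiv) fun x ↦ hfix x x.2) fun z hz ↦
      hσ z (by rw [pow_mul, hz, one_pow])

theorem AlgHom.exists_apply_eq_of_normal {k K Ω : Type*} [Field k] [Field K] [Field Ω]
    [Algebra k K] [Algebra k Ω] [Normal k K] (f g : K →ₐ[k] Ω) (x : K) : ∃ x', f x = g x' := by
  let _ : Algebra K Ω := f.toRingHom.toAlgebra
  have : IsScalarTower k K Ω := IsScalarTower.of_algebraMap_eq fun x ↦ (f.commutes x).symm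
  obtain ⟨x', rfl⟩ := (Algebra.IsAlgebraic.algHom_bijective (g.restrictNormal K)).2 x
  exact ⟨x', g.restrictNormal_commutes K x'⟩

/-- Since a ≡ 1 modulo d, the automorphism of the closure attached to a fixes the image of the d-th
cyclotomic field, hence the image of the fixed field inside it; so a belongs to H. -/
theorem mem_of_algHom_cyclotomic {d : ℕ} (hd : d ≠ 0) {C : Type*} [Field C] [Algebra ℚ C]
    [IsCyclotomicExtension {d} ℚ C] (f : cyclotomicFixedField L H →+* C) {a : ℕ}
    (had : a ≡ 1 [MOD d]) (ha : a.Coprime n) : ZMod.unitOfCoprime a ha ∈ H := by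
  have : NeZero d := ⟨hd⟩
  have hcd : a.Coprime d := by
    rw [Nat.coprime_iff_gcd_eq_one, had.gcd_eq, Nat.gcd_one_left]
  let Ω := AlgebraicClosure L
  have : Algebra.IsAlgebraic ℚ Ω := Algebra.IsAlgebraic.trans ℚ L Ω
  obtain ⟨σ, hσ⟩ := exists_algEquiv_pow_of_coprime Ω (mul_ne_zero hd (NeZero.ne n))
    (Nat.Coprime.mul_right hcd ha)
  rw [← forall_apply_eq_iff_mem (L := L) (H := H) (Ω := Ω) (σ := σ) ha fun z hz ↦
    hσ z (by rw [mul_comm, pow_mul, hz, one_pow])]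
  have : IsAbelianGalois ℚ L := IsCyclotomicExtension.isAbelianGalois {n} ℚ L
  have : FiniteDimensional ℚ C := IsCyclotomicExtension.finiteDimensional {d} _ C
  let ψ : C →ₐ[ℚ] Ω := IsAlgClosed.lift
  have hψ : σ.toAlgHom.comp ψ = ψ := by
    have hζ := IsCyclotomicExtension.zeta_spec d ℚ C
    refine (hζ.powerBasis ℚ).algHom_ext ?_
    rw [IsPrimitiveRoot.powerBasis_gen]
    have h1 : ψ (IsCyclotomicExtension.zeta d ℚ C) ^ d = 1 := by
      rw [← map_pow, hζ.pow_eq_one, map_one]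
    change σ (ψ _) = ψ _
    rw [hσ _ (by rw [pow_mul, h1, one_pow]), pow_eq_pow_mod a h1, had, ← pow_eq_pow_mod 1 h1,
      pow_one]
  intro x hx
  have : IsAbelianGalois ℚ (cyclotomicFixedField L H) :=
    .of_algHom (algebraMap (cyclotomicFixedField L H) L).toRatAlgHom
  -- The fixed field is normal over ℚ, so its embedding through L and its embedding through C have
  -- the same image.
  obtain ⟨x', hx'⟩ := AlgHom.exists_apply_eq_of_normal
    ((algebraMap L Ω).comp (algebraMap (cyclotomicFixedField L H) L)).toRatAlgHom
    (ψ.comp f.toRatAlgHom) ⟨x, hx⟩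
  have h2 : algebraMap L Ω x = ψ (f x') := hx'
  rw [h2]
  exact DFunLike.congr_fun hψ (f x')

end Galois

/-! ### Integers with prescribed residues -/

section Residues

theorem exists_modEq_of_prime {q u : ℕ} (hq : q.Prime) (hu : u.Coprime q) {M : ℕ} (hM : M ≠ 0)
    (B : ℕ) : ∃ a : ℕ, a.Coprime M ∧ a ≡ u [MOD q ^ B] ∧
      ∀ d, d ∣ M → d.Coprime q → a ≡ 1 [MOD d] := by
  obtain ⟨v, R, hR, hMR⟩ := Nat.exists_eq_pow_mul_and_not_dvd hM q hq.ne_one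
  have hqR : (q ^ (B + v)).Coprime R := Nat.Coprime.pow_left _ ((hq.coprime_iff_not_dvd).2 hR)
  obtain ⟨a, ha1, ha2⟩ := Nat.chineseRemainder hqR u 1
  have hav : a ≡ u [MOD q ^ v] := ha1.of_dvd (pow_dvd_pow _ (by omega))
  refine ⟨a, ?_, ha1.of_dvd (pow_dvd_pow _ (by omega)), fun d hd hdq ↦ ha2.of_dvd ?_⟩
  · rw [hMR]
    refine Nat.Coprime.mul_right ?_ ?_
    · rw [Nat.coprime_iff_gcd_eq_one, hav.gcd_eq]
      exact Nat.Coprime.pow_right _ hu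
    · rw [Nat.coprime_iff_gcd_eq_one, ha2.gcd_eq, Nat.gcd_one_left]
  · rw [hMR] at hd
    exact (Nat.Coprime.pow_right v hdq).dvd_of_dvd_mul_left hd

theorem one_add_sq_pow_prime_pow_modEq {p : ℕ} (hp : p.Prime) (hp2 : p ≠ 2) (e : ℕ) :
    (1 + p ^ 2) ^ p ^ e ≡ 1 [MOD p ^ (e + 2)] := by
  obtain ⟨u, -, hu⟩ := exists_geom_sum_eq_prime_pow_mul hp hp2 e
  have h := geom_sum_mul (1 + (p : ℤ) ^ 2) (p ^ e)
  rw [hu] at h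
  refine ((Nat.modEq_iff_dvd' (Nat.one_le_pow _ _ (by omega))).2 ?_).symm
  rw [← Int.natCast_dvd_natCast, Nat.cast_sub (Nat.one_le_pow _ _ (by omega))]
  push_cast
  rw [← h]
  exact ⟨u, by ring⟩

/-- Used for prime m, where `g ^ m ^ B` approximates the Teichmüller representative of g: it lifts a
class to a power of m without enlarging its order. -/
theorem pow_prime_pow_modEq_one {g m d : ℕ} (h : g ^ d ≡ 1 [MOD m]) (B : ℕ) :
    (g ^ m ^ B) ^ d ≡ 1 [MOD m ^ (B + 1)] := by
  have h1 : (m : ℤ) ∣ ((g : ℤ) ^ d) - 1 := by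
    have := (Nat.modEq_iff_dvd.1 h.symm)
    push_cast at this
    exact this
  have h2 := dvd_sub_pow_of_dvd_sub h1 B
  rw [one_pow] at h2
  refine (Nat.modEq_iff_dvd.2 ?_).symm
  push_cast
  rwa [pow_right_comm]

end Residues

/-! ### The subgroup Δ, lifts of its generator, and the conductor -/

section Example

theorem ne_of_coprime_pow_four {p m : ℕ} (hm : m ≠ 1) (h : Nat.Coprime (p ^ 4) m) : p ≠ m := by
  rintro rfl
  exact hm (Nat.Coprime.eq_one_of_dvd h.symm (dvd_pow_self _ (by norm_num)))

theorem unitsChineseRemainder_apply {p m : ℕ} (h : Nat.Coprime (p ^ 4) m)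
    (u : (ZMod (p ^ 4 * m))ˣ) : unitsChineseRemainder h u =
      (ZMod.unitsMap (Dvd.intro _ rfl) u, ZMod.unitsMap (Dvd.intro_left _ rfl) u) := by
  have e1 : (RingHom.fst _ _).comp (ZMod.chineseRemainder h).toRingHom =
    ZMod.castHom (Dvd.intro _ rfl) (ZMod (p ^ 4)) := Subsingleton.elim _ _
  have e2 : (RingHom.snd _ _).comp (ZMod.chineseRemainder h).toRingHom =
    ZMod.castHom (Dvd.intro_left _ rfl) (ZMod m) := Subsingleton.elim _ _
  ext
  · exact RingHom.congr_fun e1 (u : ZMod (p ^ 4 * m))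
  · exact RingHom.congr_fun e2 (u : ZMod (p ^ 4 * m))

theorem mem_exampleSubgroup_iff {p m : ℕ} (h : Nat.Coprime (p ^ 4) m) (γ : (ZMod m)ˣ)
    (u : (ZMod (p ^ 4 * m))ˣ) : u ∈ exampleSubgroup h γ ↔ ∃ i : ℤ,
      ZMod.unitsMap (Dvd.intro _ rfl) u =
        (ZMod.unitOfCoprime (1 + p ^ 2) (coprime_one_add_sq_pow_four p)) ^ i ∧
      ZMod.unitsMap (Dvd.intro_left _ rfl) u = γ ^ i := by
  rw [exampleSubgroup, Subgroup.mem_zpowers_iff]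
  refine exists_congr fun i ↦ ?_
  rw [← map_zpow, MulEquiv.symm_apply_eq, unitsChineseRemainder_apply, Prod.ext_iff]
  exact and_congr eq_comm eq_comm

theorem unitOfCoprime_eq_zpow_of_mem {p m : ℕ} {h : Nat.Coprime (p ^ 4) m} {γ : (ZMod m)ˣ} {a : ℕ}
    (ha : a.Coprime (p ^ 4 * m)) (haH : ZMod.unitOfCoprime a ha ∈ exampleSubgroup h γ) :
    ∃ i : ℤ, (a : ZMod (p ^ 4)) =
        ((ZMod.unitOfCoprime (1 + p ^ 2) (coprime_one_add_sq_pow_four p)) ^ i : (ZMod (p ^ 4))ˣ) ∧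
      (a : ZMod m) = (γ ^ i : (ZMod m)ˣ) := by
  obtain ⟨i, h1, h2⟩ := (mem_exampleSubgroup_iff h γ _).1 haH
  refine ⟨i, ?_, ?_⟩
  · rw [← h1, ZMod.unitsMap_val, ZMod.coe_unitOfCoprime]
    simp
  · rw [← h2, ZMod.unitsMap_val, ZMod.coe_unitOfCoprime]
    simp

theorem unitOfCoprime_mem_exampleSubgroup {p m : ℕ} {h : Nat.Coprime (p ^ 4) m} {γ : (ZMod m)ˣ} {a : ℕ}
    (ha : a.Coprime (p ^ 4 * m)) (i : ℕ) (h1 : a ≡ (1 + p ^ 2) ^ i [MOD p ^ 4])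
    (h2 : (a : ZMod m) = (γ ^ i : (ZMod m)ˣ)) :
    ZMod.unitOfCoprime a ha ∈ exampleSubgroup h γ := by
  refine (mem_exampleSubgroup_iff h γ _).2 ⟨i, ?_, ?_⟩
  · ext
    rw [ZMod.unitsMap_val, ZMod.coe_unitOfCoprime, zpow_natCast, Units.val_pow_eq_pow_val,
      ZMod.coe_unitOfCoprime, ← Nat.cast_pow, ← (ZMod.natCast_eq_natCast_iff _ _ _).2 h1]
    simp
  · ext
    rw [ZMod.unitsMap_val, ZMod.coe_unitOfCoprime, zpow_natCast, ← h2]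
    simp

theorem unitOfCoprime_mem_exampleSubgroup_of_modEq_one {p m : ℕ} {h : Nat.Coprime (p ^ 4) m} {γ : (ZMod m)ˣ}
    {a : ℕ} (ha : a.Coprime (p ^ 4 * m)) (h1 : a ≡ 1 [MOD p ^ 4 * m]) :
    ZMod.unitOfCoprime a ha ∈ exampleSubgroup h γ := by
  refine unitOfCoprime_mem_exampleSubgroup ha 0 (by simpa using h1.of_dvd (dvd_mul_right _ _)) ?_
  simpa using (ZMod.natCast_eq_natCast_iff _ _ _).2 (h1.of_dvd (dvd_mul_left _ _))

variable {p m : ℕ} [hp : Fact p.Prime]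

theorem unitOfCoprime_one_add_sq_zpow_eq_one (hp2 : p ≠ 2) {i : ℤ} (hi : (p : ℤ) ^ 2 ∣ i) :
    (ZMod.unitOfCoprime (1 + p ^ 2) (coprime_one_add_sq_pow_four p)) ^ i = 1 := by
  have h1 : (ZMod.unitOfCoprime (1 + p ^ 2) (coprime_one_add_sq_pow_four p)) ^ (p ^ 2) = 1 := by
    ext
    rw [Units.val_pow_eq_pow_val, ZMod.coe_unitOfCoprime, ← Nat.cast_pow,
      (ZMod.natCast_eq_natCast_iff _ _ _).2 (one_add_sq_pow_prime_pow_modEq hp.out hp2 2)]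
    simp
  obtain ⟨k, rfl⟩ := hi
  rw [zpow_mul, ← Nat.cast_pow, zpow_natCast, h1, one_zpow]

variable [hm : Fact m.Prime] {h : Nat.Coprime (p ^ 4) m} {γ : (ZMod m)ˣ} {j : ℕ}

/-- A lift of the generator of the subgroup which has `p`-power order modulo `N`. -/
theorem exists_lift_generator (hp2 : p ≠ 2) (h : Nat.Coprime (p ^ 4) m) (hγ : orderOf γ = p ^ j)
    {N : ℕ} (hN : N ≠ 0) {e k : ℕ} (hje : j ≤ e) (hke : k ≤ e + 2) (hk : N.factorization p = k) :
    ∃ (a : ℕ) (ha : a.Coprime (p ^ 4 * m)), a.Coprime N ∧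
      ZMod.unitOfCoprime a ha ∈ exampleSubgroup h γ ∧ a ≡ 1 + p ^ 2 [MOD p ^ (4 + k)] ∧
      (a : ZMod m) = γ ∧ a ^ p ^ e ≡ 1 [MOD N] := by
  have hpm := ne_of_coprime_pow_four hm.out.ne_one h
  have hpm' : p.Coprime m := (Nat.coprime_primes hp.out hm.out).2 hpm
  have hM : p ^ (4 + k) * (m * N) ≠ 0 :=
    mul_ne_zero (pow_ne_zero _ hp.out.ne_zero) (mul_ne_zero hm.out.ne_zero hN)
  set M := p ^ (4 + k) * (m * N) with hMdef
  have hnM : p ^ 4 * m ∣ M := ⟨p ^ k * N, by rw [hMdef, pow_add]; ring⟩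
  have hNM : N ∣ M := ⟨p ^ (4 + k) * m, by rw [hMdef]; ring⟩
  have hpM : p ^ (4 + k) ∣ M := dvd_mul_right _ _
  have hmM : m ∣ M := (dvd_mul_left _ _).trans hnM
  set v := N.factorization m with hv
  have hgm : γ.val.val.Coprime m := ZMod.val_coe_unit_coprime γ
  obtain ⟨a, haM, hap, ha1⟩ := exists_modEq_of_prime hp.out (u := 1 + p ^ 2)
    (by rw [pow_two, Nat.coprime_add_mul_left_left]; exact Nat.coprime_one_left p) hM (4 + k)
  -- By Fermat the power m^v does not change the class modulo m, while it makes the order modulo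
  -- m^(v+1) divide that of γ.
  obtain ⟨b, hbM, hbm, hb1⟩ := exists_modEq_of_prime hm.out (u := γ.val.val ^ m ^ v)
    (Nat.Coprime.pow_left _ hgm) hM (v + 1)
  have hbp := hb1 _ hpM (Nat.Coprime.pow_left _ hpm')
  have habp : a * b ≡ 1 + p ^ 2 [MOD p ^ (4 + k)] := by simpa using hap.mul hbp
  have habm : ((a * b : ℕ) : ZMod m) = γ := by
    have h1 : ((a : ℕ) : ZMod m) = (1 : ℕ) :=
      (ZMod.natCast_eq_natCast_iff _ _ _).2 (ha1 _ hmM hpm'.symm)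
    have h2 : ((b : ℕ) : ZMod m) = (γ.val.val ^ m ^ v : ℕ) :=
      (ZMod.natCast_eq_natCast_iff _ _ _).2 (hbm.of_dvd (dvd_pow_self _ (by omega)))
    rw [Nat.cast_mul, h1, h2]
    simp [ZMod.natCast_val, ZMod.cast_id, ZMod.pow_card_pow]
  have habM := haM.mul_left hbM
  refine ⟨a * b, habM.coprime_dvd_right hnM, habM.coprime_dvd_right hNM, ?_, habp, habm, ?_⟩
  · refine unitOfCoprime_mem_exampleSubgroup _ 1 ?_ (by rw [pow_one]; exact habm)
    rw [pow_one]
    exact habp.of_dvd (pow_dvd_pow _ (by omega))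
  · have key : ∀ {q c : ℕ}, q.Prime → c ≡ 1 [MOD q ^ N.factorization q] →
        (∀ d, d ∣ M → d.Coprime q → c ≡ 1 [MOD d]) → c ≡ 1 [MOD N] := by
      intro q c hq h1 h2
      have hcop : (q ^ N.factorization q).Coprime (N / q ^ N.factorization q) :=
        Nat.Coprime.pow_left _ (Nat.coprime_ordCompl hq hN)
      have h3 := (Nat.modEq_and_modEq_iff_modEq_mul hcop).1 ⟨h1,
        h2 _ ((Nat.ordCompl_dvd N q).trans hNM) (Nat.coprime_ordCompl hq hN).symm⟩
      rwa [Nat.ordProj_mul_ordCompl_eq_self] at h3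
    rw [mul_pow]
    have h1 : a ^ p ^ e ≡ 1 [MOD N] := by
      refine key hp.out ?_ fun d hd hdp ↦ by simpa using (ha1 d hd hdp).pow (p ^ e)
      rw [hk]
      exact ((hap.pow (p ^ e)).of_dvd (pow_dvd_pow _ (by omega))).trans
        ((one_add_sq_pow_prime_pow_modEq hp.out hp2 e).of_dvd (pow_dvd_pow _ hke))
    have h2 : b ^ p ^ e ≡ 1 [MOD N] := by
      refine key hm.out ?_ fun d hd hdp ↦ by simpa using (hb1 d hd hdp).pow (p ^ e)
      have h3 : γ.val.val ^ p ^ e ≡ 1 [MOD m] := by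
        rw [← ZMod.natCast_eq_natCast_iff, Nat.cast_pow, ZMod.natCast_val, ZMod.cast_id,
          ← Units.val_pow_eq_pow_val,
          orderOf_dvd_iff_pow_eq_one.1 (hγ.dvd.trans (pow_dvd_pow _ hje))]
        simp
      exact ((hbm.pow (p ^ e)).trans (pow_prime_pow_modEq_one h3 v)).of_dvd
        (pow_dvd_pow _ (by omega))
    simpa using h1.mul h2

theorem dvd_of_ringHom_cyclotomic (hp2 : p ≠ 2) (hm2 : m ≠ 2) (hj : 2 ≤ j)
    (hγ : orderOf γ = p ^ j) (L : Type*) [Field L] [NumberField L]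
    [IsCyclotomicExtension {p ^ 4 * m} ℚ L] {d : ℕ} (hd : d ≠ 0) {C : Type*} [Field C] [Algebra ℚ C]
    [IsCyclotomicExtension {d} ℚ C] (f : exampleField h γ L →+* C) : p ^ 4 * m ∣ d := by
  have hpm := ne_of_coprime_pow_four hm.out.ne_one h
  have hpm' : p.Coprime m := (Nat.coprime_primes hp.out hm.out).2 hpm
  have hM : d * (p ^ 4 * m) ≠ 0 := mul_ne_zero hd (NeZero.ne _)
  refine Nat.Coprime.mul_dvd_of_dvd_of_dvd h ?_ ?_
  · by_contra hpd
    obtain ⟨v, R, hR, hdR⟩ := Nat.exists_eq_pow_mul_and_not_dvd hd p hp.out.ne_one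
    have hv : v ≤ 3 := by
      by_contra hv
      exact hpd (hdR ▸ (pow_dvd_pow p (by omega)).mul_right R)
    -- The class 1 + p³ modulo p⁴ is invisible modulo d when v ≤ 3. It is not in Δ with trivial
    -- m-component: γ^i = 1 forces p² ∣ i, and then (1 + p²)^i = 1 modulo p⁴.
    obtain ⟨a, haM, hap, ha1⟩ := exists_modEq_of_prime hp.out (u := 1 + p ^ 3)
      (by rw [pow_succ' p 2, Nat.coprime_add_mul_left_left]; exact Nat.coprime_one_left p) hM 4
    have hRp : p.Coprime R := (hp.out.coprime_iff_not_dvd).2 hR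
    have had : a ≡ 1 [MOD d] := by
      rw [hdR, ← Nat.modEq_and_modEq_iff_modEq_mul (Nat.Coprime.pow_left _ hRp)]
      refine ⟨(hap.of_dvd (pow_dvd_pow _ (by omega))).trans ?_,
        ha1 R ((hdR ▸ dvd_mul_left _ _ : R ∣ d).mul_right _) hRp.symm⟩
      have : p ^ v ∣ p ^ 3 := pow_dvd_pow _ hv
      simpa using ((Nat.ModEq.refl 1).add ((Nat.modEq_zero_iff_dvd).2 this))
    have han := Nat.Coprime.coprime_mul_left_right haM
    obtain ⟨i, hi1, hi2⟩ := unitOfCoprime_eq_zpow_of_mem han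
      (mem_of_algHom_cyclotomic (L := L) (H := exampleSubgroup h γ) hd f had han)
    have ham : (a : ZMod m) = (1 : ℕ) := (ZMod.natCast_eq_natCast_iff _ _ _).2
      (ha1 m ((dvd_mul_left _ _).mul_left _) hpm'.symm)
    have hγi : γ ^ i = 1 := by
      ext
      rw [← hi2, ham]
      simp
    have hpi : (p : ℤ) ^ 2 ∣ i := by
      rw [← orderOf_dvd_iff_zpow_eq_one, hγ] at hγi
      exact (pow_dvd_pow _ hj).trans (by exact_mod_cast hγi)
    rw [unitOfCoprime_one_add_sq_zpow_eq_one hp2 hpi, Units.val_one, ← Nat.cast_one,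
      ZMod.natCast_eq_natCast_iff] at hi1
    have h2 : p ^ 4 ∣ (1 + p ^ 3) - 1 :=
      (Nat.modEq_iff_dvd' (by omega)).1 (hi1.symm.trans hap)
    rw [Nat.add_sub_cancel_left, Nat.pow_dvd_pow_iff_le_right hp.out.one_lt] at h2
    omega
  · by_contra hmd
    have hmd' : d.Coprime m := ((hm.out.coprime_iff_not_dvd).2 hmd).symm
    have hmp := hm.out.two_le
    -- The class of -1 modulo m has order 2, so it is not a power of γ, whose order is odd.
    obtain ⟨a, haM, ham, ha1⟩ := exists_modEq_of_prime hm.out (u := m - 1)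
      ((Nat.coprime_self_sub_left (m := 1) (n := m) (by omega)).2 (Nat.coprime_one_left m)) hM 1
    have han := Nat.Coprime.coprime_mul_left_right haM
    obtain ⟨i, hi1, hi2⟩ := unitOfCoprime_eq_zpow_of_mem han
      (mem_of_algHom_cyclotomic (L := L) (H := exampleSubgroup h γ) hd f
        (ha1 d (dvd_mul_right _ _) hmd') han)
    have ham' : (a : ZMod m) = ((m - 1 : ℕ) : ZMod m) :=
      (ZMod.natCast_eq_natCast_iff _ _ _).2 (by simpa using ham)
    rw [Nat.cast_sub (by omega), ZMod.natCast_self, zero_sub, Nat.cast_one] at ham'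
    have h3 : ((γ ^ i : (ZMod m)ˣ) : ZMod m) ^ (p ^ j) = 1 := by
      rw [← Units.val_pow_eq_pow_val, ← zpow_natCast, ← zpow_mul, mul_comm, zpow_mul,
        zpow_natCast, ← hγ, pow_orderOf_eq_one, one_zpow, Units.val_one]
    rw [← hi2, ham', ((hp.out.odd_of_ne_two hp2).pow).neg_one_pow] at h3
    have : Fact (2 < m) := ⟨by omega⟩
    exact ZMod.neg_one_ne_one h3

end Example

/-! ### Conductor and roots of unity of the example field -/

section Invariants

variable {p m : ℕ} [hp : Fact p.Prime] [hm : Fact m.Prime] {h : Nat.Coprime (p ^ 4) m}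
  {γ : (ZMod m)ˣ} {j : ℕ} (L : Type*) [Field L] [NumberField L]
  [IsCyclotomicExtension {p ^ 4 * m} ℚ L]

theorem isAbelianConductor_exampleField (hp2 : p ≠ 2) (hm2 : m ≠ 2) (hj : 2 ≤ j)
    (hγ : orderOf γ = p ^ j) : IsAbelianConductor (exampleField h γ L) (p ^ 4 * m) := by
  refine ⟨⟨NeZero.pos _, ?_⟩, ?_⟩
  · have e : L ≃ₐ[ℚ] CyclotomicField (p ^ 4 * m) ℚ :=
      @IsCyclotomicExtension.algEquiv {p ^ 4 * m} ℚ L _ _ _ _ (CyclotomicField (p ^ 4 * m) ℚ) _ _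
        (CyclotomicField.isCyclotomicExtension (p ^ 4 * m) ℚ)
    exact ⟨((e : L →+* CyclotomicField (p ^ 4 * m) ℚ).comp
      (algebraMap (exampleField h γ L) L)).toRatAlgHom⟩
  · rintro d ⟨hd, ⟨f⟩⟩
    have : NeZero d := ⟨hd.ne'⟩
    have := CyclotomicField.isCyclotomicExtension d ℚ
    exact Nat.le_of_dvd hd (@dvd_of_ringHom_cyclotomic p m _ _ h γ j hp2 hm2 hj hγ L _ _ _ d hd.ne'
      (CyclotomicField d ℚ) _ _ this f)

variable {L}

theorem dvd_sq_of_dvd_sub {a q : ℕ} (ha1 : 1 ≤ a) (hap : a ≡ 1 + p ^ 2 [MOD p ^ 4])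
    (ham : ¬ m ∣ a - 1) (hqa : q ∣ a - 1) (hqn : q ∣ p ^ 4 * m) : q ∣ p ^ 2 := by
  have hqm : q.Coprime m := by
    refine ((hm.out.coprime_iff_not_dvd).2 fun hmq ↦ ham (hmq.trans hqa)).symm
  obtain ⟨i, hi, rfl⟩ := (Nat.dvd_prime_pow hp.out).1 (hqm.dvd_of_dvd_mul_right hqn)
  have h1 : a - 1 ≡ p ^ 2 [MOD p ^ 4] := by
    refine Nat.ModEq.add_right_cancel' 1 ?_
    rwa [Nat.sub_add_cancel ha1, add_comm]
  exact ((h1.of_dvd (pow_dvd_pow _ hi)).dvd_iff dvd_rfl).1 hqa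

/-- As p⁴m is odd, x is up to sign a power of ζ_{p⁴m}. With a representing the generator of Δ, the
order of x² divides both a - 1 and p⁴m; here m ∤ a - 1 because γ ≠ 1, and a - 1 ≡ p² modulo p⁴. -/
theorem pow_eq_one_of_isOfFinOrder (hp2 : p ≠ 2) (hm2 : m ≠ 2) (hj : 1 ≤ j)
    (hγ : orderOf γ = p ^ j) {x : L} (hx : x ∈ exampleField h γ L) (hfin : IsOfFinOrder x) :
    x ^ (2 * p ^ 2) = 1 := by
  obtain ⟨a, ha, -, haH, hap, ham, -⟩ := exists_lift_generator hp2 h hγ one_ne_zero le_rfl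
    (Nat.zero_le _) (k := 0) (by simp)
  have hodd : Odd (p ^ 4 * m) :=
    ((hp.out.odd_of_ne_two hp2).pow).mul (hm.out.odd_of_ne_two hm2)
  obtain ⟨r, hr⟩ := IsPrimitiveRoot.exists_neg_pow_of_isOfFinOrder (K := L) hodd
    (IsCyclotomicExtension.zeta_spec (p ^ 4 * m) ℚ L) hfin
  have hn : (x ^ 2) ^ (p ^ 4 * m) = 1 := by
    rw [hr, ← pow_mul, ← pow_mul, show r * (2 * (p ^ 4 * m)) = 2 * ((p ^ 4 * m) * r) by ring,
      pow_mul, neg_sq, ← pow_mul, mul_left_comm, pow_mul,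
      (IsCyclotomicExtension.zeta_spec (p ^ 4 * m) ℚ L).pow_eq_one, one_pow]
  have hxa := pow_eq_self_of_mem_cyclotomicFixedField (H := exampleSubgroup h γ)
    (pow_mem hx 2) hn ha haH
  have hx0 : x ^ 2 ≠ 0 := fun h0 ↦ by
    rw [h0, zero_pow (NeZero.ne _)] at hn
    exact zero_ne_one hn
  have ha1 : 1 ≤ a := by
    refine Nat.one_le_iff_ne_zero.2 ?_
    rintro rfl
    rw [Nat.coprime_zero_left] at ha
    exact hm.out.ne_one (Nat.eq_one_of_mul_eq_one_left ha)
  have ha2 : (x ^ 2) ^ (a - 1) = 1 := by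
    apply mul_right_cancel₀ hx0
    rw [← pow_succ, Nat.sub_add_cancel ha1, one_mul, hxa]
  have hma : ¬ m ∣ a - 1 := by
    intro hd
    rw [← CharP.cast_eq_zero_iff (ZMod m), Nat.cast_sub ha1, ham, Nat.cast_one, sub_eq_zero,
      Units.val_eq_one] at hd
    rw [hd, orderOf_one] at hγ
    exact (Nat.one_lt_pow (by omega) hp.out.one_lt).ne hγ
  rw [pow_mul]
  exact orderOf_dvd_iff_pow_eq_one.1 (dvd_sq_of_dvd_sub ha1 hap hma
    (orderOf_dvd_of_pow_eq_one ha2) (orderOf_dvd_of_pow_eq_one hn))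

/-- Every element of Δ is 1 modulo p², because 1 + p² is. -/
theorem mem_exampleField_of_pow_eq_one {x : L} (hx : x ^ p ^ 2 = 1) :
    x ∈ exampleField h γ L := by
  refine mem_cyclotomicFixedField_iff.2 fun τ hτ ↦ ?_
  rw [IsCyclotomicExtension.Rat.galEquivZMod_apply_of_pow_eq (p ^ 4 * m) L τ
    (orderOf_dvd_iff_pow_eq_one.1 ((orderOf_dvd_of_pow_eq_one hx).trans
      ⟨p ^ 2 * m, by ring⟩))]
  set u := IsCyclotomicExtension.Rat.galEquivZMod (p ^ 4 * m) L τ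
  obtain ⟨i, hi, -⟩ := (mem_exampleSubgroup_iff h γ u).1 hτ
  have h1 : ZMod.unitsMap (n := p ^ 2) (m := p ^ 4) ⟨p ^ 2, by ring⟩
      (ZMod.unitOfCoprime (1 + p ^ 2) (coprime_one_add_sq_pow_four p)) = 1 := by
    ext
    rw [ZMod.unitsMap_val, ZMod.coe_unitOfCoprime, ZMod.cast_natCast ⟨p ^ 2, by ring⟩,
      Nat.cast_add, ZMod.natCast_self]
    simp
  have h2 : ZMod.unitsMap (n := p ^ 2) (m := p ^ 4 * m) ⟨p ^ 2 * m, by ring⟩ u = 1 := by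
    rw [← one_zpow i, ← h1, ← map_zpow, ← hi, ← MonoidHom.comp_apply, ZMod.unitsMap_comp]
  have h3 : u.val.val ≡ 1 [MOD p ^ 2] := by
    rw [← ZMod.natCast_eq_natCast_iff, ZMod.natCast_val, ← ZMod.unitsMap_val ⟨p ^ 2 * m, by ring⟩, h2]
    simp
  rw [pow_eq_pow_mod _ hx, h3, ← pow_eq_pow_mod _ hx, pow_one]

variable (L) in
theorem exists_isPrimitiveRoot_exampleField (h : Nat.Coprime (p ^ 4) m) (γ : (ZMod m)ˣ) :
    ∃ z : exampleField h γ L, IsPrimitiveRoot z (p ^ 2) := by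
  have hζ := (IsCyclotomicExtension.zeta_spec (p ^ 4 * m) ℚ L).pow (a := p ^ 2 * m) (b := p ^ 2)
    (NeZero.pos _) (by ring)
  exact ⟨⟨_, mem_exampleField_of_pow_eq_one hζ.pow_eq_one⟩,
    (IsPrimitiveRoot.map_iff_of_injective
      (f := algebraMap (exampleField h γ L) L) (algebraMap (exampleField h γ L) L).injective).1 hζ⟩

theorem torsion_exampleField (hp2 : p ≠ 2) (hm2 : m ≠ 2) (hj : 1 ≤ j) (hγ : orderOf γ = p ^ j) :
    CommGroup.torsion (exampleField h γ L)ˣ = rootsOfUnity (2 * p ^ 2) (exampleField h γ L) := by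
  ext x
  rw [CommGroup.mem_torsion, mem_rootsOfUnity]
  constructor
  · intro hx
    ext
    push_cast
    refine pow_eq_one_of_isOfFinOrder hp2 hm2 hj hγ (x : exampleField h γ L).2 ?_
    exact MonoidHom.isOfFinOrder (((algebraMap (exampleField h γ L) L).toMonoidHom).comp (Units.coeHom _)) hx
  · intro hx
    exact isOfFinOrder_iff_pow_eq_one.2
      ⟨_, Nat.mul_pos two_pos (pow_pos hp.out.pos 2), hx⟩

theorem numRootsOfUnity_exampleField (hp2 : p ≠ 2) (hm2 : m ≠ 2) (hj : 1 ≤ j)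
    (hγ : orderOf γ = p ^ j) : numRootsOfUnity (exampleField h γ L) = 2 * p ^ 2 := by
  obtain ⟨z, hz⟩ := exists_isPrimitiveRoot_exampleField L h γ
  have hnegz : IsPrimitiveRoot (-z) (2 * p ^ 2) := by
    convert! IsPrimitiveRoot.orderOf (-z)
    rw [neg_eq_neg_one_mul, (Commute.all _ _).orderOf_mul_eq_mul_orderOf_of_coprime]
    · simp [hz.eq_orderOf]
    · simp [← hz.eq_orderOf, hp.out.odd_of_ne_two hp2]
  have : NeZero (2 * p ^ 2) := ⟨mul_ne_zero two_ne_zero (pow_ne_zero 2 hp.out.ne_zero)⟩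
  rw [numRootsOfUnity, torsion_exampleField hp2 hm2 hj hγ]
  exact hnegz.card_rootsOfUnity

end Invariants

/-! ### Roots of unity and automorphisms in a cyclotomic extension -/

section Cyclotomic

variable {K F : Type*} [Field K] [Field F] [Algebra K F] {N : ℕ} [NeZero N]
  [IsCyclotomicExtension {N} K F]

theorem exists_isPrimitiveRoot_of_dvd (K F : Type*) [Field K] [Field F] [Algebra K F] {N : ℕ}
    [NeZero N] [IsCyclotomicExtension {N} K F] {Q : ℕ} (hQ : Q ∣ N) : ∃ ζ : F, IsPrimitiveRoot ζ Q := by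
  obtain ⟨R, hR⟩ := hQ
  exact ⟨_, (IsCyclotomicExtension.zeta_spec N K F).pow (NeZero.pos N) (hR.trans (mul_comm _ _))⟩

theorem algEquiv_pow_eq_one_of_modEq {σ : F ≃ₐ[K] F} {a i : ℕ}
    (hσ : ∀ z : F, z ^ N = 1 → σ z = z ^ a) (hai : a ^ i ≡ 1 [MOD N]) : σ ^ i = 1 := by
  have hζ := IsCyclotomicExtension.zeta_spec N K F
  have key : ∀ k : ℕ, (σ ^ k) (IsCyclotomicExtension.zeta N K F) =
      (IsCyclotomicExtension.zeta N K F) ^ (a ^ k) := by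
    intro k
    induction k with
    | zero => simp
    | succ k ih =>
      rw [pow_succ', AlgEquiv.mul_apply, ih, map_pow, hσ _ hζ.pow_eq_one, ← pow_mul, pow_succ']
  refine AlgEquiv.coe_toAlgHom_injective ((hζ.powerBasis K).algHom_ext ?_)
  rw [IsPrimitiveRoot.powerBasis_gen]
  change (σ ^ i) _ = _
  rw [key, pow_eq_pow_mod _ hζ.pow_eq_one, hai, ← pow_eq_pow_mod _ hζ.pow_eq_one, pow_one]
  rfl

end Cyclotomic

/-! ### The Chevalley-Bass property of 4p^j -/

section Property

variable {p m : ℕ} [hp : Fact p.Prime] [hm : Fact m.Prime] {h : Nat.Coprime (p ^ 4) m}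
  {γ : (ZMod m)ˣ} {j : ℕ} {L : Type*} [Field L] [NumberField L]
  [IsCyclotomicExtension {p ^ 4 * m} ℚ L]

/-- For a prime `q` other than `2` and `p`, some residue class in `Δ` has a representative not congruent to
`1` modulo `q`. -/
theorem exists_mem_exampleSubgroup_not_modEq_one (hp2 : p ≠ 2) (h : Nat.Coprime (p ^ 4) m)
    (hj : 1 ≤ j) (hγ : orderOf γ = p ^ j) {q : ℕ} (hq : q.Prime) (hq2 : q ≠ 2) (hqp : q ≠ p)
    {N : ℕ} (hN : N ≠ 0) :
    ∃ (a : ℕ) (ha : a.Coprime (p ^ 4 * m)), a.Coprime N ∧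
      ZMod.unitOfCoprime a ha ∈ exampleSubgroup h γ ∧ ¬ (q : ℤ) ∣ a - 1 := by
  by_cases hqm : q = m
  · obtain ⟨a, ha, haN, haH, -, ham, -⟩ := exists_lift_generator (N := N) (k := N.factorization p)
      (e := j + N.factorization p) hp2 h hγ hN (by omega) (by omega) rfl
    refine ⟨a, ha, haN, haH, fun hd ↦ ?_⟩
    rw [hqm, ← ZMod.intCast_zmod_eq_zero_iff_dvd] at hd
    push_cast at hd
    rw [ham, sub_eq_zero, Units.val_eq_one] at hd
    rw [hd, orderOf_one] at hγ
    exact (Nat.one_lt_pow (by omega) hp.out.one_lt).ne hγ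
  · have hq1 := hq.two_le
    -- Away from m, the class that is -1 modulo q and 1 modulo p⁴m is available, and -1 ≠ 1 modulo q
    -- because q is odd.
    obtain ⟨a, haM, haq, ha1⟩ := exists_modEq_of_prime hq (u := q - 1)
      ((Nat.coprime_self_sub_left (m := 1) (n := q) (by omega)).2 (Nat.coprime_one_left q))
      (mul_ne_zero hN (NeZero.ne (p ^ 4 * m))) 1
    have han := Nat.Coprime.coprime_mul_left_right haM
    refine ⟨a, han, Nat.Coprime.coprime_mul_right_right haM,
      unitOfCoprime_mem_exampleSubgroup_of_modEq_one han (ha1 _ (dvd_mul_left _ _) ?_), fun hd ↦ ?_⟩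
    · exact Nat.Coprime.mul_left (Nat.Coprime.pow_left _ ((Nat.coprime_primes hp.out hq).2 hqp.symm))
        ((Nat.coprime_primes hm.out hq).2 (Ne.symm hqm))
    · rw [pow_one] at haq
      have h1 : (q : ℤ) ∣ ((q - 1 : ℕ) : ℤ) - 1 :=
        (dvd_iff_dvd_of_dvd_sub (by
          rw [sub_sub_sub_cancel_right]
          exact Nat.modEq_iff_dvd.1 haq.symm)).1 hd
      rw [Nat.cast_sub (by omega)] at h1
      have h2 : (q : ℤ) ∣ 2 := by
        have := (dvd_refl (q : ℤ)).sub h1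
        rwa [show (q : ℤ) - (q - (1 : ℕ) - 1) = 2 by push_cast; ring] at this
      exact hq2 ((Nat.prime_dvd_prime_iff_eq hq Nat.prime_two).1 (by exact_mod_cast h2))

variable {F : Type*} [Field F] [Algebra (exampleField h γ L) F] {N : ℕ} [NeZero N]
  [IsCyclotomicExtension {N} (exampleField h γ L) F]

variable (h γ L F) in
theorem exists_algEquiv_exampleField {a : ℕ} (haN : a.Coprime N)
    (ha : a.Coprime (p ^ 4 * m)) (haH : ZMod.unitOfCoprime a ha ∈ exampleSubgroup h γ) :
    ∃ σ : F ≃ₐ[exampleField h γ L] F, ∀ z : F, z ^ N = 1 → σ z = z ^ a :=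
  exists_algEquiv_cyclotomicFixedField (K := exampleField h γ L) rfl F (NeZero.ne N) haN ha haH

theorem exists_pow_eq_of_ne (hp2 : p ≠ 2) (hj : 1 ≤ j) (hγ : orderOf γ = p ^ j)
    {q : ℕ} (hq : q.Prime) (hq2 : q ≠ 2) (hqp : q ≠ p) {a : ℕ} (hQN : q ^ a ∣ N)
    {x : exampleField h γ L} {y : F} (hy : y ≠ 0)
    (hyx : y ^ q ^ a = algebraMap (exampleField h γ L) F x) : ∃ z, z ^ q ^ a = x := by
  have := IsCyclotomicExtension.finiteDimensional {N} (exampleField h γ L) F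
  have := IsCyclotomicExtension.isAbelianGalois {N} (exampleField h γ L) F
  obtain ⟨ζ, hζ⟩ := exists_isPrimitiveRoot_of_dvd (exampleField h γ L) F hQN
  obtain ⟨b, hb, hbN, hbH, hbq⟩ :=
    exists_mem_exampleSubgroup_not_modEq_one hp2 h hj hγ hq hq2 hqp (NeZero.ne N)
  obtain ⟨σ, hσ⟩ := exists_algEquiv_exampleField h γ L F hbN hb hbH
  have hζN : ζ ^ N = 1 := (hζ.pow_eq_one_iff_dvd N).2 hQN
  refine exists_pow_eq_of_isCoprime (pow_ne_zero _ hq.ne_zero) hζ hy hyx (s := σ)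
    (fun g ↦ mul_comm' σ g) (χ := b) (by rw [hσ ζ hζN, zpow_natCast]) ?_
  push_cast
  exact (((Nat.prime_iff_prime_int.1 hq).coprime_iff_not_dvd.2 hbq).symm).pow_right

/-- The conductor is odd, so every odd residue modulo 2^(a+2) is realised over K by an automorphism
trivial on the roots of unity of odd order dividing N. That triviality is what makes r an involution
on all of F. -/
theorem exists_pow_eq_two (hp2 : p ≠ 2) (hm2 : m ≠ 2) {a : ℕ} (ha : 1 ≤ a)
    (hN2 : N.factorization 2 = a + 2) {x : exampleField h γ L} {y : F} (hy : y ≠ 0)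
    (hyx : y ^ (4 * 2 ^ a) = algebraMap (exampleField h γ L) F x) : ∃ z, z ^ 2 ^ a = x := by
  have := IsCyclotomicExtension.finiteDimensional {N} (exampleField h γ L) F
  have := IsCyclotomicExtension.isAbelianGalois {N} (exampleField h γ L) F
  have hQ : 4 * 2 ^ a = 2 ^ N.factorization 2 := by rw [hN2]; ring
  have hQN : 4 * 2 ^ a ∣ N := hQ ▸ Nat.ordProj_dvd N 2
  obtain ⟨ζ, hζ⟩ := exists_isPrimitiveRoot_of_dvd (exampleField h γ L) F hQN
  have hζN : ζ ^ N = 1 := (hζ.pow_eq_one_iff_dvd N).2 hQN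
  have hn2 : (p ^ 4 * m).Coprime 2 :=
    Nat.Coprime.mul_left (Nat.Coprime.pow_left _ ((Nat.coprime_primes hp.out Nat.prime_two).2 hp2))
      ((Nat.coprime_primes hm.out Nat.prime_two).2 hm2)
  -- automorphisms with prescribed action on the roots of unity of two-power order
  have key : ∀ u : ℕ, u.Coprime 2 → ∃ (σ : F ≃ₐ[exampleField h γ L] F) (b : ℕ),
      (∀ z : F, z ^ N = 1 → σ z = z ^ b) ∧ σ ζ = ζ ^ u ∧ b ≡ u [MOD 2 ^ (a + 2)] ∧
      ∀ d, d ∣ N → d.Coprime 2 → b ≡ 1 [MOD d] := by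
    intro u hu
    obtain ⟨b, hbM, hbu, hb1⟩ := exists_modEq_of_prime Nat.prime_two hu
      (mul_ne_zero (NeZero.ne N) (NeZero.ne (p ^ 4 * m))) (a + 2)
    have hbn := Nat.Coprime.coprime_mul_left_right hbM
    obtain ⟨σ, hσ⟩ := exists_algEquiv_exampleField h γ L F (Nat.Coprime.coprime_mul_right_right hbM) hbn
      (unitOfCoprime_mem_exampleSubgroup_of_modEq_one (h := h) (γ := γ) hbn
        (hb1 _ (dvd_mul_left _ _) hn2))
    refine ⟨σ, b, hσ, ?_, hbu, fun d hd ↦ hb1 d (hd.mul_right _)⟩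
    rw [hσ ζ hζN, pow_eq_pow_mod b hζ.pow_eq_one, hQ, hN2, hbu, ← hN2, ← hQ,
      ← pow_eq_pow_mod u hζ.pow_eq_one]
  obtain ⟨s, -, -, hs, -⟩ := key (4 * 2 ^ a - 1) (by
    rw [Nat.coprime_two_right]
    exact Nat.Even.sub_odd (by have := Nat.one_le_two_pow (n := a); omega)
      ((by decide : Even 4).mul_right _) odd_one)
  obtain ⟨r, b, hrN, hr, hbu, hb1⟩ := key (1 + 2 ^ (a + 1)) (by
    rw [Nat.coprime_two_right]
    exact odd_one.add_even ((even_two).pow_of_ne_zero (by omega)))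
  refine exists_pow_eq_of_two_pow ha hζ hy hyx (s := s) (r := r) (fun g ↦ mul_comm' s g) ?_ ?_ ?_
  · rw [hs, zpow_neg_one]
    refine eq_inv_of_mul_eq_one_left ?_
    rw [← pow_succ, Nat.sub_add_cancel (Nat.mul_pos (by norm_num) (by positivity)), hζ.pow_eq_one]
  · rw [hr, ← zpow_natCast]
    push_cast
    rfl
  · refine algEquiv_pow_eq_one_of_modEq hrN ?_
    have hcop : (2 ^ N.factorization 2).Coprime (N / 2 ^ N.factorization 2) :=
      Nat.Coprime.pow_left _ (Nat.coprime_ordCompl Nat.prime_two (NeZero.ne N))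
    rw [← Nat.ordProj_mul_ordCompl_eq_self N 2, ← Nat.modEq_and_modEq_iff_modEq_mul hcop, hN2]
    constructor
    · refine (hbu.pow 2).trans ?_
      rw [show (1 + 2 ^ (a + 1)) ^ 2 = 1 + 2 ^ (a + 2) * (1 + 2 ^ a) by ring]
      exact (Nat.ModEq.refl 1).add
        ((Nat.modEq_zero_iff_dvd).2 (dvd_mul_right (2 ^ (a + 2)) (1 + 2 ^ a)))
    · simpa only [hN2, one_pow] using (hb1 _ (Nat.ordCompl_dvd N 2)
        (Nat.coprime_ordCompl Nat.prime_two (NeZero.ne N)).symm).pow 2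

theorem exists_pow_eq_odd_prime (hp2 : p ≠ 2) (hj : 2 ≤ j) (hγ : orderOf γ = p ^ j) {a : ℕ}
    (hNp : N.factorization p = a + j) {x : exampleField h γ L} {y : F} (hy : y ≠ 0)
    (hyx : y ^ (p ^ j * p ^ a) = algebraMap (exampleField h γ L) F x) : ∃ z, z ^ p ^ a = x := by
  have := IsCyclotomicExtension.finiteDimensional {N} (exampleField h γ L) F
  have := IsCyclotomicExtension.isAbelianGalois {N} (exampleField h γ L) F
  have hQ : p ^ j * p ^ a = p ^ N.factorization p := by rw [hNp]; ring
  have hQN : p ^ j * p ^ a ∣ N := hQ ▸ Nat.ordProj_dvd N p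
  obtain ⟨ζ, hζ⟩ := exists_isPrimitiveRoot_of_dvd (exampleField h γ L) F hQN
  have hζN : ζ ^ N = 1 := (hζ.pow_eq_one_iff_dvd N).2 hQN
  have hp0 := hp.out.ne_zero
  -- The order of the lift must absorb both that of 1 + p² modulo p^(a+j), which needs a + j - 2,
  -- and that of γ, which needs j.
  obtain ⟨b, hb, hbN, hbH, hbp, -, hbe⟩ := exists_lift_generator hp2 h hγ (NeZero.ne N)
    (e := max (a + j - 2) j) (k := a + j) (le_max_right _ _)
    (by have := le_max_left (a + j - 2) j; omega) hNp
  obtain ⟨s, hs⟩ := exists_algEquiv_exampleField h γ L F hbN hb hbH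
  refine exists_pow_eq_of_odd_prime_pow hp.out hp2 hj (e := max (a + j - 2) j) (max_choice _ _)
    hζ hy hyx (s := s) (fun g ↦ mul_comm' s g) ?_ (algEquiv_pow_eq_one_of_modEq hs hbe) ?_
  · have hb' : b ≡ 1 + p ^ 2 [MOD p ^ N.factorization p] :=
      hbp.of_dvd (pow_dvd_pow _ (by omega))
    rw [hs ζ hζN, pow_eq_pow_mod b hζ.pow_eq_one, hQ, hb', ← hQ,
      ← pow_eq_pow_mod _ hζ.pow_eq_one, ← zpow_natCast]
    push_cast
    rfl
  · intro g χ hχ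
    -- K contains the p²-th roots of unity, so every g fixes the corresponding power of ζ, and χ ≡ 1
    -- modulo p².
    obtain ⟨z, hz⟩ := exists_isPrimitiveRoot_exampleField L h γ
    have hz' := hz.map_of_injective (algebraMap (exampleField h γ L) F).injective
    have : NeZero (p ^ 2) := ⟨pow_ne_zero _ hp0⟩
    have hpj : p ^ 2 * (p ^ (j - 2) * p ^ a) = p ^ j * p ^ a := by
      rw [← mul_assoc, ← pow_add, Nat.add_sub_cancel' hj]
    have hω : (ζ ^ (p ^ (j - 2) * p ^ a)) ^ p ^ 2 = 1 := by
      rw [← pow_mul, mul_comm, hpj, hζ.pow_eq_one]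
    obtain ⟨i, -, hi⟩ := hz'.eq_pow_of_pow_eq_one hω
    have hg : g (ζ ^ (p ^ (j - 2) * p ^ a)) = ζ ^ (p ^ (j - 2) * p ^ a) := by
      rw [← hi, ← map_pow, AlgEquiv.commutes]
    have hζ0 : ζ ≠ 0 := hζ.ne_zero (mul_ne_zero (pow_ne_zero _ hp0) (pow_ne_zero _ hp0))
    rw [map_pow, hχ, ← zpow_natCast, ← zpow_natCast, ← zpow_mul] at hg
    have h1 : ζ ^ ((χ - 1) * ((p ^ (j - 2) * p ^ a : ℕ) : ℤ)) = 1 := by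
      rw [sub_mul, zpow_sub₀ hζ0, hg, one_mul, div_self (zpow_ne_zero _ hζ0)]
    rw [hζ.zpow_eq_one_iff_dvd, ← hpj, Nat.cast_mul] at h1
    have := (mul_dvd_mul_iff_right (by
      exact_mod_cast mul_ne_zero (pow_ne_zero _ hp0) (pow_ne_zero _ hp0))).1 h1
    exact_mod_cast this

theorem hasChevalleyBassProperty_exampleField (hp2 : p ≠ 2) (hm2 : m ≠ 2) (hj : 2 ≤ j)
    (hγ : orderOf γ = p ^ j) : HasChevalleyBassProperty (exampleField h γ L) (4 * p ^ j) := by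
  have hΛ : 4 * p ^ j ≠ 0 := mul_ne_zero (by norm_num) (pow_ne_zero _ hp.out.ne_zero)
  refine ⟨Nat.pos_of_ne_zero hΛ, fun n hn x ⟨y, hyx⟩ ↦ ?_⟩
  refine exists_pow_eq_of_forall_prime x n hn.ne' fun q hq hqn ↦ ?_
  have hN : 4 * p ^ j * n ≠ 0 := mul_ne_zero hΛ hn.ne'
  have : NeZero (4 * p ^ j * n) := ⟨hN⟩
  have hcyc : IsCyclotomicExtension {4 * p ^ j * n} (exampleField h γ L)
    (CyclotomicField (4 * p ^ j * n) (exampleField h γ L)) := inferInstance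
  have ha : 1 ≤ n.factorization q := hq.factorization_pos_of_dvd hn.ne' hqn
  have hfac : ∀ q, (4 * p ^ j * n).factorization q =
      2 * (Nat.factorization 2 q) + j * (p.factorization q) + n.factorization q := by
    intro q
    rw [Nat.factorization_mul hΛ hn.ne', Nat.factorization_mul (by norm_num)
      (pow_ne_zero _ hp.out.ne_zero), Nat.factorization_pow, show 4 = 2 ^ 2 by norm_num,
      Nat.factorization_pow]
    simp
  have hroot : ∀ Q, Q ∣ 4 * p ^ j * n → ∃ y' : CyclotomicField (4 * p ^ j * n)
      (exampleField h γ L), y' ≠ 0 ∧ y' ^ Q = algebraMap (exampleField h γ L) _ x := by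
    rintro Q ⟨R, hR⟩
    refine ⟨y ^ R, pow_ne_zero _ y.ne_zero, ?_⟩
    rw [← hyx, ← pow_mul, mul_comm R Q]
    exact congrArg _ hR.symm
  have hunit : (∃ z : exampleField h γ L, z ^ q ^ n.factorization q = x) →
      ∃ z : (exampleField h γ L)ˣ, z ^ q ^ n.factorization q = x := by
    rintro ⟨z, hz⟩
    have hz0 : z ≠ 0 := by
      rintro rfl
      rw [zero_pow (pow_ne_zero _ hq.ne_zero)] at hz
      exact x.ne_zero hz.symm
    exact ⟨Units.mk0 z hz0, Units.ext (by simpa using hz)⟩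
  apply hunit
  have hqn' := Nat.ordProj_dvd n q
  by_cases hqp : q = p
  · subst hqp
    obtain ⟨y', hy', hyx'⟩ := hroot (q ^ j * q ^ n.factorization q)
      (mul_dvd_mul (dvd_mul_left _ _) hqn')
    refine exists_pow_eq_odd_prime (N := 4 * q ^ j * n) hp2 hj hγ ?_ hy' hyx'
    rw [hfac, hq.factorization_self, Nat.factorization_eq_zero_of_not_dvd
      (fun hd ↦ hp2 ((Nat.prime_dvd_prime_iff_eq hq Nat.prime_two).1 hd))]
    ring
  · by_cases hq2 : q = 2
    · subst hq2
      obtain ⟨y', hy', hyx'⟩ := hroot (4 * 2 ^ n.factorization 2)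
        (mul_dvd_mul (dvd_mul_right _ _) hqn')
      refine exists_pow_eq_two (N := 4 * p ^ j * n) hp2 hm2 ha ?_ hy' hyx'
      rw [hfac, hq.factorization_self, Nat.factorization_eq_zero_of_not_dvd
        (fun hd ↦ hqp ((Nat.prime_dvd_prime_iff_eq hq hp.out).1 hd))]
      ring
    · have hd : q ^ n.factorization q ∣ 4 * p ^ j * n := hqn'.mul_left _
      obtain ⟨y', hy', hyx'⟩ := hroot _ hd
      exact exists_pow_eq_of_ne (N := 4 * p ^ j * n) hp2 (by omega) hγ hq hq2 hqp hd hy' hyx'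

end Property

/-! ### Divisibility of every admissible integer by 4 and by p^j -/

section Minimality

open IsCyclotomicExtension.Rat

variable {p m : ℕ} [hp : Fact p.Prime] [hm : Fact m.Prime] {h : Nat.Coprime (p ^ 4) m}
  {γ : (ZMod m)ˣ} {j : ℕ} {L : Type*} [Field L] [NumberField L]
  [IsCyclotomicExtension {p ^ 4 * m} ℚ L]

theorem sq_ne_neg_one_of_exampleField (hp2 : p ≠ 2) (hm2 : m ≠ 2) (hj : 1 ≤ j)
    (hγ : orderOf γ = p ^ j) (w : exampleField h γ L) : w ^ 2 ≠ -1 := by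
  intro hw
  have hwL : (w : L) ^ 2 = -1 := by exact_mod_cast congrArg (algebraMap (exampleField h γ L) L) hw
  have h1 := pow_eq_one_of_isOfFinOrder hp2 hm2 hj hγ w.2
    (isOfFinOrder_iff_pow_eq_one.2 ⟨2 * 2, by norm_num, by
      rw [pow_mul, hwL]; norm_num⟩)
  rw [pow_mul, hwL, ((hp.out.odd_of_ne_two hp2).pow).neg_one_pow] at h1
  norm_num at h1

/-- If 4 ∤ l, some exponent 2k has l · 2k = 4r with r odd. Then (-4)^r = (1 + i)^(l · 2k), and a
root z with z^(2k) = (-4)^r would give (z^k / 2^r)² = -1. -/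
theorem HasChevalleyBassProperty.four_dvd {K : Type*} [Field K] [CharZero K]
    (hK : ∀ w : K, w ^ 2 ≠ -1) {l : ℕ} (hl : HasChevalleyBassProperty K l) : 4 ∣ l := by
  by_contra h4
  have hl0 := hl.1
  obtain ⟨r, k, hr, hrl⟩ : ∃ r k : ℕ, Odd r ∧ l * (2 * k) = 4 * r ∧ 0 < k := by
    rcases Nat.even_or_odd l with he | ho
    · obtain ⟨r, rfl⟩ := he
      refine ⟨r, 1, ?_, by ring, one_pos⟩
      by_contra hr
      obtain ⟨t, rfl⟩ := Nat.not_odd_iff_even.1 hr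
      exact h4 ⟨t, by ring⟩
    · exact ⟨l, 2, ho, by ring, two_pos⟩
  obtain ⟨hlk, hk⟩ := hrl
  have : NeZero (l * (2 * k)) := ⟨by positivity⟩
  obtain ⟨i, hi⟩ := exists_isPrimitiveRoot_of_dvd K (CyclotomicField (l * (2 * k)) K) (N := l * (2 * k))
    (Q := 4) ⟨r, hlk⟩
  have hi2 : i ^ 2 = -1 := by
    have h1 := (hi.pow (a := 2) (b := 2) (by norm_num) (by norm_num))
    exact h1.eq_neg_one_of_two_right
  have hy4 : (1 + i) ^ 4 = -4 := by
    linear_combination (i ^ 2 + 4 * i + 5) * hi2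
  have hy0 : (1 + i) ≠ 0 := by
    intro h0
    rw [h0] at hy4
    norm_num at hy4
  have hx0 : ((-4 : K)) ^ r ≠ 0 := pow_ne_zero _ (by norm_num)
  obtain ⟨z, hz⟩ := hl.2 (2 * k) (by positivity) (Units.mk0 _ hx0) ⟨Units.mk0 _ hy0, by
    rw [Units.val_mk0, Units.val_mk0, map_pow, map_neg, map_ofNat, ← hy4, ← pow_mul]
    exact congrArg _ hlk⟩
  have hz' : (z : K) ^ (2 * k) = (-4) ^ r := by
    rw [← Units.val_pow_eq_pow_val, hz, Units.val_mk0]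
  refine hK (z ^ k / 2 ^ r) ?_
  rw [div_pow, ← pow_mul, mul_comm k, hz', ← pow_mul, mul_comm r, pow_mul, ← div_pow,
    show (-4 : K) / 2 ^ 2 = -1 by norm_num, hr.neg_one_pow]

/-- The distinguished generator of the Galois group of `L` over the example field. -/
noncomputable def exampleGenerator (h : Nat.Coprime (p ^ 4) m) (γ : (ZMod m)ˣ) (L : Type*)
    [Field L] [NumberField L] [IsCyclotomicExtension {p ^ 4 * m} ℚ L] : L ≃ₐ[ℚ] L :=
  (galEquivZMod (p ^ 4 * m) L).symm ((unitsChineseRemainder h).symm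
    (ZMod.unitOfCoprime (1 + p ^ 2) (coprime_one_add_sq_pow_four p), γ))

theorem orderOf_exampleGenerator (hp2 : p ≠ 2) (hj : 2 ≤ j) (hγ : orderOf γ = p ^ j) :
    orderOf (exampleGenerator h γ L) = p ^ j := by
  rw [exampleGenerator, MulEquiv.orderOf_eq, MulEquiv.orderOf_eq, Prod.orderOf_mk, hγ]
  refine Nat.lcm_eq_right_iff_dvd.2 (orderOf_dvd_of_pow_eq_one ?_)
  rw [← zpow_natCast]
  exact unitOfCoprime_one_add_sq_zpow_eq_one hp2 (by exact_mod_cast pow_dvd_pow p hj)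

theorem mem_zpowers_exampleGenerator_iff {τ : L ≃ₐ[ℚ] L} :
    τ ∈ Subgroup.zpowers (exampleGenerator h γ L) ↔
      galEquivZMod (p ^ 4 * m) L τ ∈ exampleSubgroup h γ := by
  rw [exampleSubgroup, Subgroup.mem_zpowers_iff, Subgroup.mem_zpowers_iff]
  refine exists_congr fun i ↦ ?_
  rw [exampleGenerator, ← map_zpow, MulEquiv.symm_apply_eq]

theorem mem_exampleField_iff {x : L} :
    x ∈ exampleField h γ L ↔ exampleGenerator h γ L x = x := by
  refine ⟨fun hx ↦ mem_cyclotomicFixedField_iff.1 hx _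
    (mem_zpowers_exampleGenerator_iff.1 (Subgroup.mem_zpowers _)), fun hx ↦ ?_⟩
  refine mem_cyclotomicFixedField_iff.2 fun τ hτ ↦ ?_
  have h1 : Subgroup.zpowers (exampleGenerator h γ L) ≤ MulAction.stabilizer (L ≃ₐ[ℚ] L) x := by
    rw [Subgroup.zpowers_le]
    exact hx
  exact h1 (mem_zpowers_exampleGenerator_iff.2 hτ)

theorem exampleGenerator_apply {z : L} (hz : z ^ p ^ 4 = 1) :
    exampleGenerator h γ L z = z ^ (1 + p ^ 2) := by
  rw [galEquivZMod_apply_of_pow_eq (p ^ 4 * m) L _ (by rw [pow_mul, hz, one_pow]),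
    exampleGenerator, MulEquiv.apply_symm_apply]
  set u := (unitsChineseRemainder h).symm
    (ZMod.unitOfCoprime (1 + p ^ 2) (coprime_one_add_sq_pow_four p), γ) 
  have h1 := Prod.ext_iff.1 ((MulEquiv.apply_symm_apply (unitsChineseRemainder h) _).symm.trans
    (unitsChineseRemainder_apply h u))
  have h2 : u.val.val ≡ 1 + p ^ 2 [MOD p ^ 4] := by
    rw [← ZMod.natCast_eq_natCast_iff, ZMod.natCast_val,
      ← ZMod.unitsMap_val (Dvd.intro _ rfl) u]
    refine (congrArg Units.val h1.1).symm.trans ?_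
    rw [ZMod.coe_unitOfCoprime]
  rw [pow_eq_pow_mod _ hz, h2, ← pow_eq_pow_mod _ hz]

/-- A resolvent on which the generator acts through a primitive `p ^ j`-th root of unity. -/
theorem exists_exampleGenerator_apply_eq_mul (hp2 : p ≠ 2) (hj : 2 ≤ j) (hj4 : j ≤ 4)
    (hγ : orderOf γ = p ^ j) {ζ : L} (hζ : IsPrimitiveRoot ζ (p ^ j)) :
    ∃ y : L, y ≠ 0 ∧ exampleGenerator h γ L y = ζ * y := by
  set s := exampleGenerator h γ L with hs
  have hord : orderOf s = p ^ j := orderOf_exampleGenerator hp2 hj hγ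
  have hζ0 : ζ ≠ 0 := hζ.ne_zero (pow_ne_zero _ hp.out.ne_zero)
  have hsζ : s ζ = ζ ^ (1 + p ^ 2) := exampleGenerator_apply
    (orderOf_dvd_iff_pow_eq_one.1 (hζ.eq_orderOf ▸ pow_dvd_pow p hj4))
  -- These coefficients solve s(c i) = ζ c(i + 1) with c 0 = 1. They close up after p^j steps
  -- because p^j divides the geometric sum, that is, ζ has norm 1.
  let c : ℕ → L := fun i ↦ (ζ ^ ∑ k ∈ Finset.range i, (1 + p ^ 2) ^ k)⁻¹
  have hc0 : c 0 = 1 := by simp [c]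
  have hcp : c (p ^ j) = 1 := by
    obtain ⟨u, -, hu⟩ := exists_geom_sum_eq_prime_pow_mul hp.out hp2 j
    have h1 : p ^ j ∣ ∑ k ∈ Finset.range (p ^ j), (1 + p ^ 2) ^ k := by
      zify
      exact ⟨u, by exact_mod_cast hu⟩
    simp only [c]
    rw [(hζ.pow_eq_one_iff_dvd _).2 h1, inv_one]
  have hsc : ∀ i, s (c i) = ζ * c (i + 1) := by
    intro i
    simp only [c]
    rw [map_inv₀, map_pow, hsζ, geom_sum_succ, pow_succ ζ, mul_inv, mul_left_comm,
      mul_inv_cancel₀ hζ0, mul_one, ← pow_mul]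
  have hli : LinearIndependent L (fun i : Fin (p ^ j) ↦ ((s ^ (i : ℕ) : L ≃ₐ[ℚ] L) : L → L)) :=
    (linearIndependent_monoidHom L L).comp
      (fun i : Fin (p ^ j) ↦ ((s ^ (i : ℕ) : L ≃ₐ[ℚ] L) : L →* L)) fun i k hik ↦ by
        have h1 : s ^ (i : ℕ) = s ^ (k : ℕ) := by
          ext x
          exact DFunLike.congr_fun hik x
        exact Fin.ext (pow_injOn_Iio_orderOf (by simp [hord]) (by simp [hord]) h1)
  -- Hilbert 90: by Dedekind independence of the distinct powers of s, the resolvent is nonzero for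
  -- some t.
  obtain ⟨t, ht⟩ : ∃ t : L, ∑ i ∈ Finset.range (p ^ j), c i * (s ^ i) t ≠ 0 := by
    by_contra! hall
    have h1 := Fintype.linearIndependent_iff.1 hli (fun i ↦ c i) (by
      ext t
      simp only [Finset.sum_apply, Pi.smul_apply, smul_eq_mul, Pi.zero_apply]
      rw [← hall t, Finset.sum_range]) ⟨0, pow_pos hp.out.pos _⟩
    rw [hc0] at h1
    exact one_ne_zero h1
  refine ⟨_, ht, ?_⟩
  rw [map_sum]
  have h2 : ∀ i, s (c i * (s ^ i) t) = ζ * (c (i + 1) * (s ^ (i + 1)) t) := by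
    intro i
    rw [map_mul, hsc, pow_succ', AlgEquiv.mul_apply, mul_assoc]
  simp only [h2]
  rw [← Finset.mul_sum]
  congr 1
  have h3 := Finset.sum_range_succ (fun i ↦ c i * (s ^ i) t) (p ^ j)
  rw [Finset.sum_range_succ', hc0, hcp, ← hord, pow_orderOf_eq_one, hord, pow_zero] at h3
  exact add_right_cancel h3

/-- An element of Δ trivial modulo m is an i-th power of the generator with p^j ∣ i; since j ≥ 2 it
is also trivial modulo p⁴. -/
theorem adjoin_eq_top_of_isPrimitiveRoot (hp2 : p ≠ 2) (hj : 2 ≤ j) (hγ : orderOf γ = p ^ j)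
    {ω : L} (hω : IsPrimitiveRoot ω m) :
    IntermediateField.adjoin (exampleField h γ L) {ω} = ⊤ := by
  have : IsGalois ℚ L := IsCyclotomicExtension.isGalois {p ^ 4 * m} ℚ L
  rw [← IsGalois.fixedField_fixingSubgroup
    (IntermediateField.adjoin (exampleField h γ L) {ω})]
  suffices hbot : (IntermediateField.adjoin (exampleField h γ L) {ω}).fixingSubgroup = ⊥ by
    rw [hbot, IntermediateField.fixedField_bot]
  rw [eq_bot_iff]
  intro g hg
  have hgω : g ω = ω := (IntermediateField.mem_fixingSubgroup_iff _ _).1 hg ω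
    (IntermediateField.mem_adjoin_simple_self _ ω)
  have hmem : g.restrictScalars ℚ ∈ (exampleField h γ L).fixingSubgroup :=
    (IntermediateField.mem_fixingSubgroup_iff _ _).2 fun x hx ↦ g.commutes ⟨x, hx⟩
  have hfix : (exampleField h γ L).fixingSubgroup =
      (exampleSubgroup h γ).comap (galEquivZMod (p ^ 4 * m) L).toMonoidHom :=
    IntermediateField.fixingSubgroup_fixedField _
  rw [hfix] at hmem
  set u := galEquivZMod (p ^ 4 * m) L (g.restrictScalars ℚ) with hu
  obtain ⟨i, hi1, hi2⟩ := (mem_exampleSubgroup_iff h γ u).1 hmem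
  have hum : ZMod.unitsMap (Dvd.intro_left _ rfl : m ∣ p ^ 4 * m) u = 1 := by
    have h1 : g.restrictScalars ℚ ω = ω ^ u.val.val :=
      galEquivZMod_apply_of_pow_eq (p ^ 4 * m) L _
        ((hω.pow_eq_one_iff_dvd _).2 (dvd_mul_left _ _))
    have h2 : ω ^ u.val.val = ω ^ 1 := by
      rw [← h1, pow_one]
      exact hgω
    rw [(hω.isOfFinOrder hm.out.ne_zero).pow_inj_mod, ← hω.eq_orderOf,
      ← ZMod.natCast_eq_natCast_iff', ZMod.natCast_val] at h2
    ext
    rw [ZMod.unitsMap_val, h2]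
    simp
  rw [hum, eq_comm, ← orderOf_dvd_iff_zpow_eq_one, hγ] at hi2
  rw [unitOfCoprime_one_add_sq_zpow_eq_one hp2
    ((pow_dvd_pow _ hj).trans (by exact_mod_cast hi2))] at hi1
  have hu1 : u = 1 := by
    rw [← (unitsChineseRemainder h).map_eq_one_iff, unitsChineseRemainder_apply, hi1, hum]
    rfl
  rw [hu, MulEquiv.map_eq_one_iff] at hu1
  exact Subgroup.mem_bot.2 (AlgEquiv.ext fun x ↦ DFunLike.congr_fun hu1 x)

theorem nonempty_algHom_of_dvd (hp2 : p ≠ 2) (hj : 2 ≤ j) (hγ : orderOf γ = p ^ j)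
    {F : Type*} [Field F] [Algebra (exampleField h γ L) F] {N : ℕ} [NeZero N]
    [IsCyclotomicExtension {N} (exampleField h γ L) F] (hmN : m ∣ N) :
    Nonempty (L →ₐ[exampleField h γ L] F) := by
  have hω := (IsCyclotomicExtension.zeta_spec (p ^ 4 * m) ℚ L).pow (NeZero.pos _) (b := m) rfl
  obtain ⟨ω', hω'⟩ := exists_isPrimitiveRoot_of_dvd (exampleField h γ L) F hmN
  refine IntermediateField.nonempty_algHom_of_adjoin_splits (S := {_}) (fun s hs ↦ ?_)
    (adjoin_eq_top_of_isPrimitiveRoot hp2 hj hγ hω)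
  rw [Set.mem_singleton_iff] at hs
  rw [hs]
  refine ⟨Algebra.IsIntegral.isIntegral _, ?_⟩
  have hsplit := (Polynomial.X_pow_sub_one_splits hω')
  have hdvd : minpoly (exampleField h γ L) (IsCyclotomicExtension.zeta (p ^ 4 * m) ℚ L ^ p ^ 4) ∣
      Polynomial.X ^ m - 1 := minpoly.dvd _ _ (by simp [hω.pow_eq_one])
  refine Polynomial.Splits.of_dvd ?_ ?_ (Polynomial.map_dvd (algebraMap _ F) hdvd)
  · simpa using hsplit
  · simpa using Polynomial.X_pow_sub_C_ne_zero hm.out.pos (1 : F)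

/-- Let s y = ζ y with ζ of order p^j; a power of y lies in K exactly when p^j divides the exponent.
If p^j ∤ l, an n with ord_p(ln) = j puts y^(ln) in K. Were it z^n, then y^(ln/p) would lie in K too,
although ord_p(ln/p) = j - 1. -/
theorem HasChevalleyBassProperty.pow_dvd (hp2 : p ≠ 2) (hj : 2 ≤ j) (hj4 : j ≤ 4)
    (hγ : orderOf γ = p ^ j) {l : ℕ} (hl : HasChevalleyBassProperty (exampleField h γ L) l) :
    p ^ j ∣ l := by
  have hl0 := hl.1
  by_contra hjl
  have hb : l.factorization p < j := by
    by_contra! hle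
    exact hjl ((pow_dvd_pow p hle).trans (Nat.ordProj_dvd l p))
  obtain ⟨t, ht⟩ := Nat.exists_eq_add_of_lt hb
  -- The power of p raises the valuation of l n to exactly j; the factor m makes L, and hence y,
  -- embed into K(ζ_{ln}).
  set n := p ^ (t + 1) * m with hn
  have hn0 : n ≠ 0 := NeZero.ne _
  have : NeZero (l * n) := ⟨mul_ne_zero hl0.ne' hn0⟩
  have hfac : (l * n).factorization p = j := by
    rw [Nat.factorization_mul hl0.ne' hn0, hn, Nat.factorization_mul
      (pow_ne_zero _ hp.out.ne_zero) hm.out.ne_zero, Finsupp.add_apply, Finsupp.add_apply,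
      hp.out.factorization_pow, Finsupp.single_eq_same, Nat.factorization_eq_zero_of_not_dvd
        fun hd ↦ ne_of_coprime_pow_four hm.out.ne_one h
          ((Nat.prime_dvd_prime_iff_eq hp.out hm.out).1 hd), ht]
    ring
  have hζ := (IsCyclotomicExtension.zeta_spec (p ^ 4 * m) ℚ L).pow (NeZero.pos _)
    (a := p ^ (4 - j) * m) (b := p ^ j) (by
      rw [mul_right_comm, ← pow_add, Nat.sub_add_cancel hj4])
  obtain ⟨y, hy0, hy⟩ := exists_exampleGenerator_apply_eq_mul (h := h) hp2 hj hj4 hγ hζ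
  set ζ := IsCyclotomicExtension.zeta (p ^ 4 * m) ℚ L ^ (p ^ (4 - j) * m)
  have hyk : ∀ k, exampleGenerator h γ L (y ^ k) = ζ ^ k * y ^ k := fun k ↦ by
    rw [map_pow, hy, mul_pow]
  have hyN : y ^ (l * n) ∈ exampleField h γ L := by
    rw [mem_exampleField_iff, hyk, (hζ.pow_eq_one_iff_dvd _).2, one_mul]
    rw [← hfac]
    exact Nat.ordProj_dvd _ _
  obtain ⟨ι⟩ := nonempty_algHom_of_dvd (h := h) (L := L)
    (F := CyclotomicField (l * n) (exampleField h γ L)) (N := l * n) hp2 hj hγ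
    ((dvd_mul_left m (p ^ (t + 1))).mul_left l)
  have hx0 : (⟨y ^ (l * n), hyN⟩ : exampleField h γ L) ≠ 0 := fun h0 ↦
    pow_ne_zero (l * n) hy0 (congrArg Subtype.val h0)
  have hιy : ι y ≠ 0 := (map_ne_zero ι).2 hy0
  obtain ⟨z, hz⟩ := hl.2 n (Nat.pos_of_ne_zero hn0) (Units.mk0 _ hx0) ⟨Units.mk0 _ hιy, by
    rw [Units.val_mk0, Units.val_mk0, ← map_pow, ← ι.commutes]
    rfl⟩
  have hz' : ((z : exampleField h γ L) : L) ^ n = y ^ (l * n) :=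
    congrArg (fun v : (exampleField h γ L)ˣ ↦ ((v : exampleField h γ L) : L)) hz
  have hz0 : ((z : exampleField h γ L) : L) ≠ 0 := fun h0 ↦ by
    rw [h0, zero_pow hn0] at hz'
    exact pow_ne_zero _ hy0 hz'.symm
  -- the quotient of the two roots is a `p`-th root of unity, hence lies in the field
  set k := p ^ t * m with hk
  have hkn : n = k * p := by rw [hn, hk]; ring
  have hw : (y ^ (l * k) / ((z : exampleField h γ L) : L) ^ k) ∈ exampleField h γ L := by
    refine mem_exampleField_of_pow_eq_one ?_
    rw [pow_two, pow_mul, div_pow, ← pow_mul, ← pow_mul, mul_assoc, ← hkn, hz',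
      div_self (pow_ne_zero _ hy0), one_pow]
  have hyk' : y ^ (l * k) ∈ exampleField h γ L := by
    have := mul_mem hw (pow_mem (z : exampleField h γ L).2 k)
    rwa [div_mul_cancel₀ _ (pow_ne_zero _ hz0)] at this
  rw [mem_exampleField_iff, hyk, mul_eq_right₀ (pow_ne_zero _ hy0), hζ.pow_eq_one_iff_dvd] at hyk'
  have h5 : p ^ (j + 1) ∣ l * n := by
    rw [hkn, ← mul_assoc, pow_succ]
    exact mul_dvd_mul_right hyk' p
  rw [hp.out.pow_dvd_iff_le_factorization (NeZero.ne _), hfac] at h5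
  omega

end Minimality

/-! ### The allowed integers and the final assembly -/

section Main

theorem ne_two_of_pow_four_dvd_sub_one {p m : ℕ} (hp : p.Prime) (hm : p ^ 4 ∣ m - 1) : m ≠ 2 := by
  rintro rfl
  exact hp.one_lt.ne' (Nat.dvd_one.1 ((dvd_pow_self p (by norm_num)).trans hm))

theorem chevalleyBassUpperBound_eq {p m : ℕ} (hp : p.Prime) (hp2 : p ≠ 2) (hm : m.Prime)
    (hm2 : m ≠ 2) (hpm : p ≠ m) : chevalleyBassUpperBound (p ^ 4 * m) (2 * p ^ 2) = 4 * p ^ 4 := by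
  have hodd : Odd (p ^ 4 * m) := ((hp.odd_of_ne_two hp2).pow).mul (hm.odd_of_ne_two hm2)
  have h2 : ¬ 2 ∣ p ^ 4 * m := hodd.not_two_dvd_nat
  have hp4 : p ^ 4 ≠ 0 := pow_ne_zero _ hp.ne_zero
  have hfac : (p ^ 4 * m).factorization p = 4 := by
    rw [Nat.factorization_mul hp4 hm.ne_zero, Finsupp.add_apply, hp.factorization_pow,
      Finsupp.single_eq_same, Nat.factorization_eq_zero_of_not_dvd
        fun hd ↦ hpm ((Nat.prime_dvd_prime_iff_eq hp hm).1 hd)]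
  rw [chevalleyBassUpperBound, if_neg fun h4 ↦ h2 ((by norm_num : 2 ∣ 4).trans h4),
    Nat.primeFactors_mul two_ne_zero (pow_ne_zero _ hp.ne_zero), Nat.prime_two.primeFactors,
    Nat.primeFactors_prime_pow two_ne_zero hp, Finset.prod_union (by simpa using hp2.symm),
    Finset.prod_singleton, Finset.prod_singleton, hfac, Nat.factorization_eq_zero_of_not_dvd h2,
    pow_zero, one_mul]

theorem allowedChevalleyBassNumbers_eq {p m : ℕ} (hp : p.Prime) (hp2 : p ≠ 2) (hm : m.Prime)
    (hm2 : m ≠ 2) (hpm : p ≠ m) : allowedChevalleyBassNumbers (p ^ 4 * m) (2 * p ^ 2) =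
      {4 * p ^ 2, 4 * p ^ 3, 4 * p ^ 4} := by
  have hp0 : 0 < p ^ 2 := pow_pos hp.pos 2
  have hdiv : 4 * p ^ 4 / (2 * p ^ 2) = 2 * p ^ 2 :=
    Nat.div_eq_of_eq_mul_left (by positivity) (by ring)
  have hlcm : Nat.lcm 4 (2 * p ^ 2) = 4 * p ^ 2 := by
    rw [show 4 = 2 * 2 by norm_num, Nat.lcm_mul_left, Nat.Coprime.lcm_eq_mul, mul_assoc]
    exact Nat.Coprime.pow_right _ ((Nat.coprime_primes Nat.prime_two hp).2 hp2.symm)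
  ext d
  rw [allowedChevalleyBassNumbers, chevalleyBassUpperBound_eq hp hp2 hm hm2 hpm, hdiv,
    Nat.lcm_self, hlcm]
  simp only [Set.mem_ofPred_eq, Set.mem_insert_iff, Set.mem_singleton_iff]
  constructor
  · rintro ⟨⟨t, rfl⟩, h2⟩
    rw [show p ^ 4 = p ^ 2 * p ^ 2 by ring, ← mul_assoc,
      Nat.mul_dvd_mul_iff_left (by positivity)] at h2
    obtain ⟨i, hi, rfl⟩ := (Nat.dvd_prime_pow hp).1 h2
    interval_cases i
    · left; ring
    · right; left; ring
    · right; right; ring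
  · rintro (rfl | rfl | rfl)
    · exact ⟨dvd_rfl, mul_dvd_mul_left _ (pow_dvd_pow _ (by norm_num))⟩
    · exact ⟨mul_dvd_mul_left _ (pow_dvd_pow _ (by norm_num)),
        mul_dvd_mul_left _ (pow_dvd_pow _ (by norm_num))⟩
    · exact ⟨mul_dvd_mul_left _ (pow_dvd_pow _ (by norm_num)), dvd_rfl⟩

theorem isChevalleyBassNumber_exampleField {p m : ℕ} [hp : Fact p.Prime] [hm : Fact m.Prime]
    {h : Nat.Coprime (p ^ 4) m} {γ : (ZMod m)ˣ} {j : ℕ} (L : Type*) [Field L] [NumberField L]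
    [IsCyclotomicExtension {p ^ 4 * m} ℚ L] (hp2 : p ≠ 2) (hm2 : m ≠ 2) (hj : 2 ≤ j) (hj4 : j ≤ 4)
    (hγ : orderOf γ = p ^ j) : IsChevalleyBassNumber (exampleField h γ L) (4 * p ^ j) := by
  refine ⟨hasChevalleyBassProperty_exampleField hp2 hm2 hj hγ, fun l hl ↦ ?_⟩
  refine Nat.le_of_dvd hl.1 (Nat.Coprime.mul_dvd_of_dvd_of_dvd ?_
    (hl.four_dvd (sq_ne_neg_one_of_exampleField hp2 hm2 (by omega) hγ))
    (hl.pow_dvd hp2 hj hj4 hγ))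
  rw [show 4 = 2 ^ 2 by norm_num]
  exact Nat.Coprime.pow _ _ ((Nat.coprime_primes Nat.prime_two hp.out).2 hp2.symm)

theorem exists_units_orderOf_eq {p m : ℕ} [hm : Fact m.Prime] (h : p ^ 4 ∣ m - 1) {j : ℕ}
    (hj : j ≤ 4) : ∃ γ : (ZMod m)ˣ, orderOf γ = p ^ j := by
  obtain ⟨g, hg⟩ := IsCyclic.exists_ofOrder_eq_natCard (α := (ZMod m)ˣ)
  rw [Nat.card_eq_fintype_card, ZMod.card_units] at hg
  obtain ⟨t, ht⟩ := (pow_dvd_pow p hj).trans h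
  refine ⟨g ^ t, ?_⟩
  have hpos : 0 < p ^ j * t := ht ▸ Nat.sub_pos_of_lt hm.out.one_lt
  rw [orderOf_pow_of_dvd (Nat.pos_of_mul_pos_left hpos).ne' (hg ▸ ht ▸ dvd_mul_left _ _), hg, ht,
    Nat.mul_div_cancel _ (Nat.pos_of_mul_pos_left hpos)]

theorem mainTheorem8 (p : ℕ) [Fact p.Prime] (hp : p ≠ 2) :
    (∃ m : ℕ, m.Prime ∧ p ^ 4 ∣ m - 1) ∧
    ∀ (m : ℕ) [Fact m.Prime] (hm : p ^ 4 ∣ m - 1)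
      (L : Type*) [Field L] [NumberField L] [IsCyclotomicExtension {p ^ 4 * m} ℚ L],
      (∀ γ : (ZMod m)ˣ, orderOf γ ∈ ({p ^ 2, p ^ 3, p ^ 4} : Set ℕ) →
        IsAbelianConductor (exampleField (coprime_pow_four_of_dvd_sub_one hm) γ L) (p ^ 4 * m) ∧
        numRootsOfUnity (exampleField (coprime_pow_four_of_dvd_sub_one hm) γ L) = 2 * p ^ 2) ∧
      (∀ γ : (ZMod m)ˣ, orderOf γ = p ^ 2 →
        IsChevalleyBassNumber (exampleField (coprime_pow_four_of_dvd_sub_one hm) γ L)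
          (4 * p ^ 2)) ∧
      (∀ γ : (ZMod m)ˣ, orderOf γ = p ^ 3 →
        IsChevalleyBassNumber (exampleField (coprime_pow_four_of_dvd_sub_one hm) γ L)
          (4 * p ^ 3)) ∧
      (∀ γ : (ZMod m)ˣ, orderOf γ = p ^ 4 →
        IsChevalleyBassNumber (exampleField (coprime_pow_four_of_dvd_sub_one hm) γ L)
          (4 * p ^ 4)) ∧
      allowedChevalleyBassNumbers (p ^ 4 * m) (2 * p ^ 2) = {4 * p ^ 2, 4 * p ^ 3, 4 * p ^ 4} ∧
      {Λ : ℕ | ∃ γ : (ZMod m)ˣ, orderOf γ ∈ ({p ^ 2, p ^ 3, p ^ 4} : Set ℕ) ∧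
        IsChevalleyBassNumber (exampleField (coprime_pow_four_of_dvd_sub_one hm) γ L) Λ} =
        allowedChevalleyBassNumbers (p ^ 4 * m) (2 * p ^ 2) := by
  have hpp : p.Prime := Fact.out
  refine ⟨?_, fun m hmp hm L _ _ _ ↦ ?_⟩
  · obtain ⟨m, hm, -, hmod⟩ := Nat.exists_prime_gt_modEq_one 1 (pow_ne_zero 4 hpp.ne_zero)
    exact ⟨m, hm, (Nat.modEq_iff_dvd' hm.one_lt.le).1 hmod.symm⟩
  have hm2 := ne_two_of_pow_four_dvd_sub_one hpp hm
  have hpm := ne_of_coprime_pow_four hmp.out.ne_one (coprime_pow_four_of_dvd_sub_one hm)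
  have hexp : ∀ d : ℕ, d ∈ ({p ^ 2, p ^ 3, p ^ 4} : Set ℕ) → ∃ j, 2 ≤ j ∧ j ≤ 4 ∧ d = p ^ j := by
    rintro d (rfl | rfl | rfl)
    exacts [⟨2, by norm_num, by norm_num, rfl⟩, ⟨3, by norm_num, by norm_num, rfl⟩,
      ⟨4, by norm_num, by norm_num, rfl⟩]
  have hcb : ∀ (j : ℕ), 2 ≤ j → j ≤ 4 → ∀ γ : (ZMod m)ˣ, orderOf γ = p ^ j →
      IsChevalleyBassNumber (exampleField (coprime_pow_four_of_dvd_sub_one hm) γ L) (4 * p ^ j) :=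
    fun j hj hj4 γ hγ ↦ isChevalleyBassNumber_exampleField L hp hm2 hj hj4 hγ
  have hallowed := allowedChevalleyBassNumbers_eq hpp hp hmp.out hm2 hpm
  refine ⟨fun γ hγ ↦ ?_, hcb 2 le_rfl (by norm_num), hcb 3 (by norm_num) (by norm_num),
    hcb 4 (by norm_num) le_rfl, hallowed, ?_⟩
  · obtain ⟨j, hj, -, hγj⟩ := hexp _ hγ
    exact ⟨isAbelianConductor_exampleField L hp hm2 hj hγj,
      numRootsOfUnity_exampleField hp hm2 (by omega) hγj⟩
  · rw [hallowed]
    ext l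
    constructor
    · rintro ⟨γ, hγ, hl⟩
      rcases hγ with hγ | hγ | hγ
      · exact .inl (hl.unique (hcb 2 (by norm_num) (by norm_num) γ hγ))
      · exact .inr (.inl (hl.unique (hcb 3 (by norm_num) (by norm_num) γ hγ)))
      · exact .inr (.inr (hl.unique (hcb 4 (by norm_num) (by norm_num) γ hγ)))
    · rintro (rfl | rfl | rfl)
      · obtain ⟨γ, hγ⟩ := exists_units_orderOf_eq hm (j := 2) (by norm_num)
        exact ⟨γ, .inl hγ, hcb 2 (by norm_num) (by norm_num) γ hγ⟩
      · obtain ⟨γ, hγ⟩ := exists_units_orderOf_eq hm (j := 3) (by norm_num)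
        exact ⟨γ, .inr (.inl hγ), hcb 3 (by norm_num) (by norm_num) γ hγ⟩
      · obtain ⟨γ, hγ⟩ := exists_units_orderOf_eq hm (j := 4) (by norm_num)
        exact ⟨γ, .inr (.inr hγ), hcb 4 (by norm_num) (by norm_num) γ hγ⟩

end Main
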